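/- Consider a two-player zero-sum matrix game with finite non-empty action sets $\mathcal A,\mathcal B$, $K=|\mathcal A|+|\mathcal B|$. Each pair $(a,b)$ carries a probability law on $[0,1]$ with mean $\ell(a,b)$; for mixed policies put $\ell(\mu,\nu)=\sum_{a,b}\mu(a)\nu(b)\ell(a,b)$ and $$\mathrm{EG}(\mu,\nu)=\max_{\nu'\in\Delta_{\mathcal B}}\ell(\mu,\nu')-\min_{\mu'\in\Delta_{\mathcal A}}\ell(\mu',\nu).$$ At each round $t=0,1,2,\dots$, given the past, the min-player draws $a^t\sim\mu^t$ and the max-player independently draws $b^t\sim\nu^t$; a loss $\ell^t\in[0,1]$ is then drawn from the law attached to $(a^t,b^t)$. Each player observes their own action and $\ell^t$. Let $\eta,\tau,\delta>0$, let $T_0\ge 2$ be an integer, and put $\eta^t=\eta\,(t+T_0)^{-3/4}$, $\tau^t=\tau\log\!\big(\tfrac{t+T_0}{\delta}\big)(t+T_0)^{-1/4}$. With the log-barrier $\Psi(w)=-\sum_i\log w_i$ and its Bregman divergence $D_\Psi(w,w')=\Psi(w)-\Psi(w')-\langle\nabla\Psi(w'),w-w'\rangle$, the players run regularized mirror descent: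 $\mu^0$ and $\nu^0$ are uniform and $$\mu^{t+1}=\operatorname*{argmin}_{\mu\in\Delta_{\mathcal A}}\;D_\Psi(\mu,\mu^t)+\eta^t\langle\hat\ell^t_{\min},\mu\rangle,\qquad \nu^{t+1}=\operatorname*{argmin}_{\nu\in\Delta_{\mathcal B}}\;D_\Psi(\nu,\nu^t)+\eta^t\langle\hat\ell^t_{\max},\nu\rangle,$$ $$\hat\ell^t_{\min}(a)=\frac{\ell^t}{\mu^t(a)}\mathbf 1_{a=a^t}+\tau^t\,\nabla\Psi(\mu^t)_a,\qquad \hat\ell^t_{\max}(b)=\frac{1-\ell^t}{\nu^t(b)}\mathbf 1_{b=b^t}+\tau^t\,\nabla\Psi(\nu^t)_b .$$ **Theorem.** For every $K$ and every $\delta>0$ there is a constant $c=c(K,\delta)>0$ such that the following holds for every such game with $|\mathcal A|+|\mathcal B|=K$. If $$\frac1{\eta\tau}\le c,\qquad \eta\le c,\qquad \eta\tau\le\frac{T_0}{\log(T_0)^4},\qquad T_0\le\log(1/\delta)^2\,\tau^4,$$ then with probability at least $1-\delta$, simultaneously for all $t\ge 0$, $$\mathrm{EG}(\mu^t,\nu^t)\le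 2K\tau\log\!\Big(\frac{t+T_0}{\delta}\Big)(t+T_0)^{-1/4}.$$ -/

import Mathlib

open MeasureTheory ProbabilityTheory

noncomputable section

/-- A two-player zero-sum matrix game with stochastic losses: playing the pair of actions `(a, b)`
produces a random loss in `[0, 1]` with law `law a b`. -/
structure MatrixGame (A B : Type*) where
  law : A → B → ProbabilityMeasure unitInterval

namespace MatrixGame

variable {A B : Type*}

/-- Expected loss of a pair of actions. -/
def meanLoss (G : MatrixGame A B) (a : A) (b : B) : ℝ :=
  ∫ x, (x : ℝ) ∂(G.law a b : Measure unitInterval)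

variable [Fintype A] [Fintype B]

/-- Expected loss `ℓ(μ, ν)` of a pair of mixed policies. -/
def expectedLoss (G : MatrixGame A B) (μ : A → ℝ) (ν : B → ℝ) : ℝ :=
  ∑ a, ∑ b, μ a * ν b * G.meanLoss a b

/-- The exploitability gap `max_{ν'} ℓ(μ, ν') - min_{μ'} ℓ(μ', ν)`, the policies `μ'` and `ν'`
ranging over the whole simplices. -/
def exploitabilityGap (G : MatrixGame A B) (μ : A → ℝ) (ν : B → ℝ) : ℝ :=
  (⨆ ν' : stdSimplex ℝ B, G.expectedLoss μ ν'.1) - ⨅ μ' : stdSimplex ℝ A, G.expectedLoss μ'.1 ν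

end MatrixGame

section MirrorDescent

variable {I : Type*} [Fintype I] [DecidableEq I]

/-- The gradient of a function on `ℝ^I`, as the vector of its partial derivatives. -/
def grad (f : (I → ℝ) → ℝ) (w : I → ℝ) (i : I) : ℝ :=
  fderiv ℝ f w (Pi.single i 1)

/-- The Bregman divergence `D_Ψ(x, y)`. -/
def bregman (Ψ : (I → ℝ) → ℝ) (x y : I → ℝ) : ℝ :=
  Ψ x - Ψ y - ∑ i, grad Ψ y i * (x i - y i)

/-- The log-barrier. It is only used at vectors with positive coordinates. -/
def logBarrier (w : I → ℝ) : ℝ := -∑ i, Real.log (w i)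

/-- The policies at which the log-barrier is finite. -/
def posSimplex (I : Type*) [Fintype I] : Set (I → ℝ) :=
  {w | (∀ i, 0 < w i) ∧ ∑ i, w i = 1}

theorem grad_logBarrier (w : I → ℝ) (hw : ∀ i, 0 < w i) (i : I) :
    grad (logBarrier (I := I)) w i = -(w i)⁻¹ := by
  have h : HasFDerivAt (logBarrier (I := I))
      (-∑ j, (w j)⁻¹ • (ContinuousLinearMap.proj j : (I → ℝ) →L[ℝ] ℝ)) w := by
    unfold logBarrier
    refine HasFDerivAt.neg (HasFDerivAt.fun_sum fun j _ => ?_)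
    exact (ContinuousLinearMap.proj (R := ℝ) (φ := fun _ : I => ℝ) j).hasFDerivAt.log (hw j).ne'
  unfold grad
  rw [h.fderiv]
  simp [Pi.single_apply]

/-- The learning rate `η^t = η (t + T₀)^(-3/4)`. -/
def learningRate (η : ℝ) (T₀ t : ℕ) : ℝ := η * ((t : ℝ) + T₀) ^ (-(3 / 4) : ℝ)

/-- The regularization strength `τ^t = τ log((t + T₀) / δ) (t + T₀)^(-1/4)`. -/
def regStrength (τ δ : ℝ) (T₀ t : ℕ) : ℝ :=
  τ * Real.log (((t : ℝ) + T₀) / δ) * ((t : ℝ) + T₀) ^ (-(1 / 4) : ℝ)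

/-- The importance-sampling estimate of the loss vector of a player who plays the policy `w`, draws
the action `a` and suffers the loss `x`. -/
def importanceEstimate (w : I → ℝ) (a : I) (x : ℝ) (i : I) : ℝ :=
  if i = a then x / w i else 0

/-- The regularized importance-sampling estimate, used as the step of the mirror descent. -/
def regularizedEstimate (τt : ℝ) (w : I → ℝ) (a : I) (x : ℝ) (i : I) : ℝ :=
  importanceEstimate w a x i + τt * grad logBarrier w i

/-- `w'` is the result of the mirror step from `w` with learning rate `ηt` and step `ξ`, for the
log-barrier: it minimizes `D_Ψ(v, w) + ηt ⟨ξ, v⟩` over the policies `v` (since the log-barrier is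
`+∞` at a policy with a zero coordinate, over those with positive coordinates). -/
def IsMirrorStep (ηt : ℝ) (ξ w w' : I → ℝ) : Prop :=
  w' ∈ posSimplex I ∧
    IsMinOn (fun v => bregman logBarrier v w + ηt * ∑ i, ξ i * v i) (posSimplex I) w'

/-- The sequence of policies `w` of one player is the one computed by the regularized mirror descent
with log-barrier, when the actions that the player draws are `act` and the losses that the
player suffers are `x`. -/
structure IsAlgorithmRun (η τ δ : ℝ) (T₀ : ℕ) (act : ℕ → I) (x : ℕ → ℝ) (w : ℕ → I → ℝ) :
    Prop where
  init : ∀ i, w 0 i = 1 / (Fintype.card I : ℝ)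
  step : ∀ t, IsMirrorStep (learningRate η T₀ t)
    (regularizedEstimate (regStrength τ δ T₀ t) (w t) (act t) (x t)) (w t) (w (t + 1))

end MirrorDescent

/-- The interaction protocol with bandit feedback. The σ-algebra `𝓕 t` is the information available
before round `t` (past actions, past losses, and possibly some extra randomness); the policies are
predictable; given `𝓕 t`, the two actions of round `t` are drawn independently from the policies
`μ t` and `ν t`, and the observed loss is then drawn from the law attached to these actions. -/
structure IsBanditPlay {A B Ω : Type*} [MeasurableSpace A] [MeasurableSpace B]
    [mΩ : MeasurableSpace Ω] (G : MatrixGame A B) (P : Measure Ω) (𝓕 : Filtration ℕ mΩ)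
    (μ : ℕ → Ω → A → ℝ) (ν : ℕ → Ω → B → ℝ)
    (act₁ : ℕ → Ω → A) (act₂ : ℕ → Ω → B) (loss : ℕ → Ω → unitInterval) : Prop where
  measurable_policy₁ : ∀ t, Measurable[𝓕 t] (μ t)
  measurable_policy₂ : ∀ t, Measurable[𝓕 t] (ν t)
  measurable_act₁ : ∀ t, Measurable[𝓕 (t + 1)] (act₁ t)
  measurable_act₂ : ∀ t, Measurable[𝓕 (t + 1)] (act₂ t)
  measurable_loss : ∀ t, Measurable[𝓕 (t + 1)] (loss t)
  cond_law : ∀ (t : ℕ) (a : A) (b : B) (S : Set unitInterval), MeasurableSet S →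
    P⟦{ω | act₁ t ω = a ∧ act₂ t ω = b ∧ loss t ω ∈ S} | 𝓕 t⟧
      =ᵐ[P] fun ω => μ t ω a * ν t ω b * (G.law a b : Measure unitInterval).real S

/-- The condition on the parameters `η`, `τ`, `T₀`, the requirements `1 / (η τ) = o(1)` and
`η = o(1)` being read as smallness up to the constant `c`. -/
structure ParameterCondition (c δ η τ : ℝ) (T₀ : ℕ) : Prop where
  eta_pos : 0 < η
  tau_pos : 0 < τ
  two_le : 2 ≤ T₀
  inv_le : 1 / (η * τ) ≤ c
  eta_le : η ≤ c
  mul_le : η * τ ≤ (T₀ : ℝ) / Real.log T₀ ^ 4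
  le_pow : (T₀ : ℝ) ≤ Real.log (1 / δ) ^ 2 * τ ^ 4

end

/-!
The proof compares the random policies with a deterministic path: the Euler scheme, started at the
uniform policies, for the mirror flow of the `τ^t`-regularized game with exact feedback. Because the
game is zero-sum, the interaction between the two players is skew-symmetric, and the squared
stationarity residual of the scheme stays small although the regularization strength drifts. A
policy with a small residual is an approximate equilibrium, with exploitability gap slightly above
`K τ^t`.

The Bregman divergence of the log-barrier is the Itakura–Saito divergence. Summed over the two
players, the divergence `Φ` between the path and the policies satisfies, by skew-symmetry again,
`E[Φ^{t+1} | 𝓕^t] ≤ (1 - h/2) Φ^t + 5 K (η² + h²)` with `η = η^t` and `h = η^t τ^t`. The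
contraction factor compensates the decrease of `(τ^t)²`, and the errors, divided by
`(τ^{t+1})² / 16`, have total at most `δ`. So `Φ^t / ((τ^t)² / 16)`, which starts at `0`, is a
nonnegative supermartingale up to these errors, and by the maximal inequality it stays below `1` for
all times with probability at least `1 - δ`. Then the policies are so close to the path that the gap
is at most `2 K τ^t`.
-/

noncomputable section

open Finset
open scoped Matrix

/-! ### The Bregman divergence of the log-barrier -/

section Divergence

variable {I : Type*} [Fintype I]

/-- The Itakura–Saito divergence `∑ᵢ (xᵢ / yᵢ - 1 - log (xᵢ / yᵢ))`: the Bregman divergence of the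
log-barrier in closed form, see `bregman_logBarrier`. -/
def itakuraSaito (x y : I → ℝ) : ℝ := ∑ i, (x i / y i - 1 - Real.log (x i / y i))

theorem sub_one_sub_log_nonneg {r : ℝ} (hr : 0 < r) : 0 ≤ r - 1 - Real.log r := by
  linarith [Real.log_le_sub_one_of_pos hr]

theorem sq_sqrt_sub_one_le_sub_one_sub_log {r : ℝ} (hr : 0 < r) :
    (√r - 1) ^ 2 ≤ r - 1 - Real.log r := by
  have hlog := Real.log_le_sub_one_of_pos (Real.sqrt_pos.2 hr)
  rw [Real.log_sqrt hr.le] at hlog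
  nlinarith [Real.sq_sqrt hr.le]

theorem sub_two_mul_sq_le_log_one_add {g : ℝ} (hg : -(1 / 2) ≤ g) :
    g - 2 * g ^ 2 ≤ Real.log (1 + g) := by
  have hpos : 0 < 1 + g := by linarith
  refine le_trans ?_ (Real.one_sub_inv_le_log_of_pos hpos)
  have hdiff : 1 - (1 + g)⁻¹ - (g - 2 * g ^ 2) = g ^ 2 * (1 + 2 * g) / (1 + g) := by
    field_simp; ring
  have : 0 ≤ g ^ 2 * (1 + 2 * g) / (1 + g) :=
    div_nonneg (mul_nonneg (sq_nonneg g) (by linarith)) hpos.le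
  linarith

theorem div_sub_one_sub_log_add_le {x w w' η ξ : ℝ} (hx : 0 < x) (hw : 0 < w) (hw' : 0 < w')
    (hξ : -(1 / 2) ≤ η * (w * ξ)) :
    (x / w' - 1 - Real.log (x / w')) + (w⁻¹ - w'⁻¹ + η * ξ) * (x - w') ≤
      (x / w - 1 - Real.log (x / w)) + η * (ξ * (x - w)) + 2 * (η * (w * ξ)) ^ 2 := by
  set g := η * (w * ξ) with hg
  have hg_pos : 0 < 1 + g := by linarith
  have hlog_g := sub_two_mul_sq_le_log_one_add hξ
  have hlog_ratio := Real.log_le_sub_one_of_pos (mul_pos (div_pos hw' hw) hg_pos)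
  rw [Real.log_mul (div_pos hw' hw).ne' hg_pos.ne', Real.log_div hw'.ne' hw.ne'] at hlog_ratio
  rw [Real.log_div hx.ne' hw.ne', Real.log_div hx.ne' hw'.ne']
  have hexpand : (w⁻¹ - w'⁻¹ + η * ξ) * (x - w') = x / w - x / w' + 1 - w' / w
      + η * (ξ * (x - w)) + g * (1 - w' / w) := by
    rw [hg]; field_simp; ring
  rw [hexpand]
  linarith

variable {x y : I → ℝ}

theorem itakuraSaito_nonneg (hx : ∀ i, 0 < x i) (hy : ∀ i, 0 < y i) : 0 ≤ itakuraSaito x y :=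
  sum_nonneg fun i _ => sub_one_sub_log_nonneg (div_pos (hx i) (hy i))

theorem div_sub_one_sub_log_le_itakuraSaito (hx : ∀ i, 0 < x i) (hy : ∀ i, 0 < y i) (i : I) :
    x i / y i - 1 - Real.log (x i / y i) ≤ itakuraSaito x y :=
  single_le_sum (f := fun i => x i / y i - 1 - Real.log (x i / y i))
    (fun i _ => sub_one_sub_log_nonneg (div_pos (hx i) (hy i))) (mem_univ i)

theorem itakuraSaito_le_sum_sq_div_mul (hx : ∀ i, 0 < x i) (hy : ∀ i, 0 < y i) :
    itakuraSaito x y ≤ ∑ i, (x i - y i) ^ 2 / (x i * y i) := by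
  refine sum_le_sum fun i _ => ?_
  have hlog := Real.one_sub_inv_le_log_of_pos (div_pos (hx i) (hy i))
  have hsq : (x i - y i) ^ 2 / (x i * y i) = x i / y i - 1 - (1 - (x i / y i)⁻¹) := by
    have := (hx i).ne'
    have := (hy i).ne'
    field_simp
  linarith

theorem mul_exp_neg_le_of_itakuraSaito_le (hx : ∀ i, 0 < x i) (hy : ∀ i, 0 < y i) {C : ℝ}
    (h : itakuraSaito x y ≤ C) (i : I) : y i * Real.exp (-(C + 1)) ≤ x i := by
  have hr := div_pos (hx i) (hy i)
  have hlog : -(C + 1) ≤ Real.log (x i / y i) := by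
    linarith [div_sub_one_sub_log_le_itakuraSaito hx hy i]
  rw [mul_comm, ← le_div_iff₀ (hy i)]
  exact (Real.le_log_iff_exp_le hr).1 hlog

theorem abs_sub_le_of_itakuraSaito_le_sq (hx : ∀ i, 0 < x i) (hy : ∀ i, 0 < y i) {d : ℝ}
    (hd₀ : 0 ≤ d) (hd₁ : d ≤ 1) (h : itakuraSaito x y ≤ d ^ 2) (i : I) :
    |x i - y i| ≤ y i * (3 * d) := by
  set s := √(x i / y i)
  have hr := div_pos (hx i) (hy i)
  have hs : |s - 1| ≤ d := abs_le_of_sq_le_sq ((sq_sqrt_sub_one_le_sub_one_sub_log hr).trans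
    ((div_sub_one_sub_log_le_itakuraSaito hx hy i).trans h)) hd₀
  have hs' : |s + 1| ≤ 3 := by
    rw [abs_of_nonneg (by positivity)]
    linarith [(abs_le.1 hs).2]
  have hfactor : x i - y i = y i * ((s - 1) * (s + 1)) := by
    have hsq : s ^ 2 = x i / y i := Real.sq_sqrt hr.le
    have : (s - 1) * (s + 1) = x i / y i - 1 := by linear_combination hsq
    rw [this, mul_sub_one, mul_div_cancel₀ _ (hy i).ne']
  rw [hfactor, abs_mul, abs_of_pos (hy i), abs_mul, mul_comm (3 : ℝ)]
  exact mul_le_mul_of_nonneg_left (mul_le_mul hs hs' (abs_nonneg _) hd₀) (hy i).le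

theorem sum_abs_sub_le_of_itakuraSaito_le_sq (hx : ∀ i, 0 < x i) (hy : y ∈ posSimplex I) {d : ℝ}
    (hd₀ : 0 ≤ d) (hd₁ : d ≤ 1) (h : itakuraSaito x y ≤ d ^ 2) : ∑ i, |x i - y i| ≤ 3 * d :=
  calc ∑ i, |x i - y i| ≤ ∑ i, y i * (3 * d) :=
        sum_le_sum fun i _ => abs_sub_le_of_itakuraSaito_le_sq hx hy.1 hd₀ hd₁ h i
    _ = 3 * d := by rw [← sum_mul, hy.2, one_mul]

end Divergence

section MirrorStep

variable {I : Type*} [Fintype I]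

theorem le_one_of_mem_posSimplex {x : I → ℝ} (hx : x ∈ posSimplex I) (i : I) : x i ≤ 1 := by
  rw [← hx.2]
  exact single_le_sum (fun i _ => (hx.1 i).le) (mem_univ i)

theorem nonempty_of_mem_posSimplex {x : I → ℝ} (hx : x ∈ posSimplex I) : Nonempty I := by
  by_contra hI
  rw [not_nonempty_iff] at hI
  simpa using hx.2

theorem convex_posSimplex : Convex ℝ (posSimplex I) := by
  rintro x ⟨hx, hx'⟩ y ⟨hy, hy'⟩ a b ha hb hab
  refine ⟨fun i => ?_, by simp [sum_add_distrib, ← mul_sum, hx', hy', hab]⟩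
  exact convex_Ioi (0 : ℝ) (hx i) (hy i) ha hb hab

theorem differentiableAt_logBarrier {w : I → ℝ} (hw : ∀ i, 0 < w i) :
    DifferentiableAt ℝ logBarrier w :=
  .neg <| .fun_sum fun i _ => (differentiableAt_apply i w).log (hw i).ne'

variable [DecidableEq I]

theorem fderiv_apply_eq_sum_grad (f : (I → ℝ) → ℝ) (w v : I → ℝ) :
    fderiv ℝ f w v = ∑ i, grad f w i * v i := by
  conv_lhs => rw [pi_eq_sum_univ' v]
  simp [grad, mul_comm]

theorem sum_grad_sub_grad_mul_sub_nonneg {Ψ : (I → ℝ) → ℝ} {s : Set (I → ℝ)} (hs : Convex ℝ s)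
    {η : ℝ} {ξ w w' x : I → ℝ} (hΨ : DifferentiableAt ℝ Ψ w') (hw' : w' ∈ s) (hx : x ∈ s)
    (hmin : IsMinOn (fun v => bregman Ψ v w + η * ∑ i, ξ i * v i) s w') :
    0 ≤ ∑ i, (grad Ψ w' i - grad Ψ w i + η * ξ i) * (x i - w' i) := by
  have hproj (i : I) : HasFDerivAt (fun v : I → ℝ => v i) (.proj i : (I → ℝ) →L[ℝ] ℝ) w' :=
    hasFDerivAt_apply i w'
  have hlin (c : I → ℝ) : HasFDerivAt (fun v : I → ℝ => ∑ i, c i * v i)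
      (∑ i, c i • (.proj i : (I → ℝ) →L[ℝ] ℝ)) w' :=
    .fun_sum fun i _ => (hproj i).const_mul (c i)
  have hgrad : HasFDerivAt (fun v : I → ℝ => ∑ i, grad Ψ w i * (v i - w i))
      (∑ i, grad Ψ w i • (.proj i : (I → ℝ) →L[ℝ] ℝ)) w' :=
    .fun_sum fun i _ => ((hproj i).sub_const (w i)).const_mul (grad Ψ w i)
  have hderiv := ((hΨ.hasFDerivAt.sub_const (Ψ w)).sub hgrad).add ((hlin ξ).const_mul η)
  have hnonneg := hmin.localize.hasFDerivWithinAt_nonneg hderiv.hasFDerivWithinAt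
    (sub_mem_posTangentConeAt_of_segment_subset (hs.segment_subset hw' hx))
  simp only [add_apply, sub_apply, smul_apply, _root_.sum_apply, ContinuousLinearMap.proj_apply,
    fderiv_apply_eq_sum_grad, smul_eq_mul, mul_sum, Pi.sub_apply] at hnonneg
  rw [← sum_sub_distrib, ← sum_add_distrib] at hnonneg
  refine hnonneg.trans_eq (sum_congr rfl fun i _ => ?_)
  ring

theorem bregman_logBarrier {x y : I → ℝ} (hx : ∀ i, 0 < x i) (hy : ∀ i, 0 < y i) :
    bregman logBarrier x y = itakuraSaito x y := by
  have hterm (i : I) : grad logBarrier y i * (x i - y i) = -(x i / y i) + 1 := by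
    have := (hy i).ne'
    rw [grad_logBarrier y hy]
    field_simp
    ring
  simp only [bregman, hterm, logBarrier, itakuraSaito, sum_add_distrib, sum_sub_distrib,
    sum_neg_distrib, fun i => Real.log_div (hx i).ne' (hy i).ne']
  ring

variable {η : ℝ} {ξ w w' x : I → ℝ}

theorem IsMirrorStep.sum_inv_sub_inv_add_mul_sub_nonneg (hw : ∀ i, 0 < w i)
    (h : IsMirrorStep η ξ w w') (hx : x ∈ posSimplex I) :
    0 ≤ ∑ i, ((w i)⁻¹ - (w' i)⁻¹ + η * ξ i) * (x i - w' i) := by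
  have := sum_grad_sub_grad_mul_sub_nonneg convex_posSimplex
    (differentiableAt_logBarrier h.1.1) h.1 hx h.2
  simpa only [grad_logBarrier w hw, grad_logBarrier w' h.1.1, neg_sub_neg] using this

theorem IsMirrorStep.itakuraSaito_step_le (hw : w ∈ posSimplex I) (h : IsMirrorStep η ξ w w') :
    itakuraSaito w' w ≤ η * ∑ i, ξ i * (w i - w' i) := by
  have hle := isMinOn_iff.1 h.2 w hw
  rw [bregman_logBarrier h.1.1 hw.1, bregman_logBarrier hw.1 hw.1] at hle
  have hself : itakuraSaito w w = 0 := by simp [itakuraSaito, (hw.1 _).ne']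
  simp only [mul_sub, sum_sub_distrib]
  linarith

theorem IsMirrorStep.itakuraSaito_le (hw : w ∈ posSimplex I) (h : IsMirrorStep η ξ w w')
    (hx : x ∈ posSimplex I) (hξ : ∀ i, -(1 / 2) ≤ η * (w i * ξ i)) :
    itakuraSaito x w' ≤ itakuraSaito x w + η * ∑ i, ξ i * (x i - w i)
      + 2 * ∑ i, (η * (w i * ξ i)) ^ 2 := by
  have hopt := h.sum_inv_sub_inv_add_mul_sub_nonneg hw.1 hx
  have hsum := sum_le_sum fun i (_ : i ∈ univ) =>
    div_sub_one_sub_log_add_le (hx.1 i) (hw.1 i) (h.1.1 i) (hξ i)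
  simp only [sum_add_distrib, ← mul_sum] at hsum
  unfold itakuraSaito
  linarith

end MirrorStep

section Loss

variable {I J : Type*}

/-- The loss matrix seen by the opponent, who suffers `1 - ℓ` when the player suffers `ℓ`. -/
def opponentLoss (M : Matrix I J ℝ) : Matrix J I ℝ := Matrix.of fun j i => 1 - M i j

theorem opponentLoss_mem_Icc {M : Matrix I J ℝ} (hM : ∀ i j, M i j ∈ Set.Icc (0 : ℝ) 1) (j : J)
    (i : I) : opponentLoss M j i ∈ Set.Icc (0 : ℝ) 1 :=
  ⟨sub_nonneg.2 (hM i j).2, sub_le_self _ (hM i j).1⟩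

theorem opponentLoss_opponentLoss (M : Matrix I J ℝ) : opponentLoss (opponentLoss M) = M := by
  ext i j
  simp [opponentLoss]

variable [Fintype J]

theorem abs_mulVec_le {M : Matrix I J ℝ} (hM : ∀ i j, M i j ∈ Set.Icc (0 : ℝ) 1) (q : J → ℝ)
    (i : I) : |(M *ᵥ q) i| ≤ ∑ j, |q j| := by
  refine (abs_sum_le_sum_abs _ _).trans (sum_le_sum fun j _ => ?_)
  rw [abs_mul, abs_of_nonneg (hM i j).1]
  exact mul_le_of_le_one_left (abs_nonneg _) (hM i j).2

theorem mulVec_mem_Icc {M : Matrix I J ℝ} (hM : ∀ i j, M i j ∈ Set.Icc (0 : ℝ) 1) {q : J → ℝ}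
    (hq : q ∈ posSimplex J) (i : I) : (M *ᵥ q) i ∈ Set.Icc (0 : ℝ) 1 := by
  refine ⟨sum_nonneg fun j _ => mul_nonneg (hM i j).1 (hq.1 j).le, ?_⟩
  rw [← hq.2]
  exact sum_le_sum fun j _ => mul_le_of_le_one_left (hq.1 j).le (hM i j).2

theorem abs_mulVec_mul_le {M : Matrix I J ℝ} (hM : ∀ i j, M i j ∈ Set.Icc (0 : ℝ) 1)
    {q v : J → ℝ} {ε : ℝ} (hq : q ∈ posSimplex J) (hv : ∀ j, |v j| ≤ ε) (i : I) :
    |(M *ᵥ (q * v)) i| ≤ ε :=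
  calc |(M *ᵥ (q * v)) i| ≤ ∑ j, |q j * v j| := abs_mulVec_le hM _ i
    _ ≤ ∑ j, q j * ε := sum_le_sum fun j _ => by
      rw [abs_mul, abs_of_pos (hq.1 j)]
      exact mul_le_mul_of_nonneg_left (hv j) (hq.1 j).le
    _ = ε := by rw [← sum_mul, hq.2, one_mul]

variable [Fintype I]

theorem dotProduct_mulVec_add_dotProduct_opponentLoss_mulVec (M : Matrix I J ℝ) (p : I → ℝ)
    (q : J → ℝ) : p ⬝ᵥ M *ᵥ q + q ⬝ᵥ opponentLoss M *ᵥ p = (∑ i, p i) * ∑ j, q j := by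
  have hswap : q ⬝ᵥ opponentLoss M *ᵥ p = ∑ i, ∑ j, q j * (opponentLoss M j i * p i) := by
    simp only [dotProduct, Matrix.mulVec, mul_sum]
    exact sum_comm
  rw [hswap, sum_mul_sum]
  simp only [dotProduct, Matrix.mulVec, mul_sum, opponentLoss, Matrix.of_apply, ← sum_add_distrib]
  refine sum_congr rfl fun i _ => sum_congr rfl fun j _ => ?_
  ring

end Loss

section Residual

variable {I : Type*} [Fintype I]

/-- The Lagrange multiplier of the constraint `∑ᵢ xᵢ = 1` in the minimization of
`⟨F, x⟩ - τ ∑ᵢ log xᵢ`. Away from the minimizer it is fixed by asking that `kktResidual` be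
orthogonal to `x`. -/
def multiplier (τ : ℝ) (F x : I → ℝ) : ℝ := (τ - ∑ i, x i ^ 2 * F i) / ∑ i, x i ^ 2

/-- The relative violation at `x` of the optimality condition `xᵢ (Fᵢ + m) = τ` for the
minimization of `⟨F, x⟩ - τ ∑ᵢ log xᵢ` over the simplex. -/
def kktResidual (τ : ℝ) (F x : I → ℝ) (i : I) : ℝ := x i * (F i + multiplier τ F x) / τ - 1

variable {τ : ℝ} {F x : I → ℝ}

theorem sum_sq_pos_of_mem_posSimplex (hx : x ∈ posSimplex I) : 0 < ∑ i, x i ^ 2 :=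
  have := nonempty_of_mem_posSimplex hx
  sum_pos (fun i _ => pow_pos (hx.1 i) 2) univ_nonempty

theorem mul_add_multiplier (hτ : τ ≠ 0) (F x : I → ℝ) (i : I) :
    x i * (F i + multiplier τ F x) = τ * (1 + kktResidual τ F x i) := by
  unfold kktResidual
  field_simp
  ring

theorem sum_mul_kktResidual (hτ : τ ≠ 0) (F : I → ℝ) (hx : x ∈ posSimplex I) :
    ∑ i, x i * kktResidual τ F x i = 0 := by
  have hterm (i : I) : x i * kktResidual τ F x i =
      (x i ^ 2 * F i + x i ^ 2 * multiplier τ F x) / τ - x i := by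
    unfold kktResidual; ring
  have hsq := (sum_sq_pos_of_mem_posSimplex hx).ne'
  simp only [hterm, sum_sub_distrib, ← sum_div, sum_add_distrib, ← sum_mul, hx.2, multiplier]
  field_simp
  ring

theorem sum_sq_kktResidual_le (hτ : τ ≠ 0) (F : I → ℝ) (hx : x ∈ posSimplex I) (c : ℝ) :
    ∑ i, kktResidual τ F x i ^ 2 ≤ ∑ i, (x i * (F i + c) / τ - 1) ^ 2 := by
  set d := (c - multiplier τ F x) / τ
  have hterm (i : I) : (x i * (F i + c) / τ - 1) ^ 2 = kktResidual τ F x i ^ 2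
      + 2 * d * (x i * kktResidual τ F x i) + (x i * d) ^ 2 := by
    have : x i * (F i + c) / τ - 1 = kktResidual τ F x i + x i * d := by
      simp only [kktResidual, d]; field_simp; ring
    rw [this]; ring
  simp only [hterm, sum_add_distrib, ← mul_sum, sum_mul_kktResidual hτ F hx]
  have : 0 ≤ ∑ i, (x i * d) ^ 2 := sum_nonneg fun i _ => sq_nonneg _
  linarith

theorem dotProduct_sub_le_of_abs_kktResidual_le {ε : ℝ} (hτ : 0 < τ) (hε : ε ≤ 1) (F : I → ℝ)
    (hx : x ∈ posSimplex I) (hu : ∀ i, |kktResidual τ F x i| ≤ ε) (i : I) :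
    x ⬝ᵥ F - F i ≤ τ * (Fintype.card I * (1 + ε)) := by
  have hF : -multiplier τ F x ≤ F i := by
    have hpos : 0 ≤ x i * (F i + multiplier τ F x) := by
      rw [mul_add_multiplier hτ.ne']
      exact mul_nonneg hτ.le (by linarith [neg_le_of_abs_le (hu i)])
    linarith [nonneg_of_mul_nonneg_right hpos (hx.1 i)]
  have hsum : x ⬝ᵥ F + multiplier τ F x = τ * ∑ k, (1 + kktResidual τ F x k) := by
    rw [mul_sum, ← sum_congr rfl fun k _ => mul_add_multiplier hτ.ne' F x k]
    simp only [mul_add, sum_add_distrib, ← sum_mul, hx.2, one_mul, dotProduct]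
  have hcard : ∑ k, (1 + kktResidual τ F x k) ≤ Fintype.card I * (1 + ε) := by
    rw [← nsmul_eq_mul, ← card_univ]
    exact sum_le_card_nsmul univ _ (1 + ε) fun k _ => by linarith [le_of_abs_le (hu k)]
  linarith [mul_le_mul_of_nonneg_left hcard hτ.le]

theorem const_inv_card_mem_posSimplex [Nonempty I] :
    (fun _ : I => 1 / (Fintype.card I : ℝ)) ∈ posSimplex I :=
  ⟨fun _ => by positivity, by simp⟩

theorem sum_sq_kktResidual_const_inv_card_le [Nonempty I] (hτ : τ ≠ 0)
    (hF : ∀ i, F i ∈ Set.Icc (0 : ℝ) 1) :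
    ∑ i, kktResidual τ F (fun _ => 1 / (Fintype.card I : ℝ)) i ^ 2 ≤ 1 / τ ^ 2 := by
  have hcard : (1 : ℝ) ≤ Fintype.card I := by exact_mod_cast Fintype.card_pos
  have hterm (i : I) : (1 / (Fintype.card I : ℝ) * (F i + Fintype.card I * τ) / τ - 1) ^ 2 ≤
      1 / τ ^ 2 / Fintype.card I := by
    have heq : (1 / (Fintype.card I : ℝ) * (F i + Fintype.card I * τ) / τ - 1) ^ 2 =
        F i ^ 2 / τ ^ 2 / (Fintype.card I : ℝ) ^ 2 := by field_simp; ring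
    rw [heq]
    gcongr
    · exact pow_le_one₀ (hF i).1 (hF i).2
    · exact le_self_pow₀ hcard two_ne_zero
  calc _ ≤ _ := sum_sq_kktResidual_le hτ F const_inv_card_mem_posSimplex (Fintype.card I * τ)
    _ ≤ ∑ _ : I, 1 / τ ^ 2 / Fintype.card I := sum_le_sum fun i _ => hterm i
    _ = 1 / τ ^ 2 := by
      rw [sum_const, card_univ, nsmul_eq_mul]
      field_simp

end Residual

/-! ### Euler scheme of the regularized game -/

section EulerStep

/-- The relation between the parameters of a round that keeps the reference path inside the ball of
radius `ε` for the norm of its residuals: `K` is the number of actions of both players, `η` and `τ`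
are the learning rate and the regularization strength of the round, and `τ'` is the regularization
strength of the next round. -/
structure AdmissibleRound (K ε η τ τ' : ℝ) : Prop where
  eps_pos : 0 < ε
  eps_le : ε ≤ 1 / 8
  card_mul_le : 64 * K * ε ^ 2 ≤ 1
  eta_pos : 0 < η
  eta_le_one : η ≤ 1
  tau_pos : 0 < τ
  tau_pos' : 0 < τ'
  mul_le_half : η * τ ≤ 1 / 2
  four_mul_eta_le : 4 * η ≤ τ
  abs_ratio_sub_one_le : |τ / τ' - 1| ≤ η * τ * ε ^ 2 / 2

variable {K ε η τ τ' : ℝ}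

theorem AdmissibleRound.mul_pos (h : AdmissibleRound K ε η τ τ') : 0 < η * τ :=
  _root_.mul_pos h.eta_pos h.tau_pos

theorem sq_add_le_add_div_mul_sq {h : ℝ} (h₀ : 0 < h) (h₁ : h ≤ 1) (a b : ℝ) :
    (a + b) ^ 2 ≤ (1 + h / 2) * a ^ 2 + 3 / h * b ^ 2 := by
  have hyoung : (1 + h / 2) * a ^ 2 + 3 / h * b ^ 2 - (a + b) ^ 2 =
      2 / h * (h / 2 * a - b) ^ 2 + (1 - h) / h * b ^ 2 := by
    field_simp; ring
  have : 0 ≤ 2 / h * (h / 2 * a - b) ^ 2 := by positivity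
  have : 0 ≤ (1 - h) / h * b ^ 2 := mul_nonneg (div_nonneg (sub_nonneg.2 h₁) h₀.le) (sq_nonneg b)
  linarith

theorem AdmissibleRound.abs_remainder_le (h : AdmissibleRound K ε η τ τ') {u g : ℝ}
    (hu : |u| ≤ ε) (hg : |g| ≤ ε) :
    |-(η * τ) * u * (u - g) + (τ / τ' - 1) * ((1 - η * τ * u) * (1 + u - g))| ≤
      3 * (η * τ) * ε ^ 2 := by
  have hpos := h.mul_pos
  have hε := h.eps_le
  have hsub : |u - g| ≤ 2 * ε := (abs_sub _ _).trans (by linarith)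
  have hquad : |-(η * τ) * u * (u - g)| ≤ η * τ * ε * (2 * ε) := by
    rw [abs_mul, abs_mul, abs_neg, abs_of_pos hpos]
    have := h.eps_pos
    gcongr
  have hshrink : |1 - η * τ * u| ≤ 17 / 16 := by
    refine (abs_sub _ _).trans ?_
    rw [abs_one, abs_mul, abs_of_pos hpos]
    have : η * τ * |u| ≤ 1 / 2 * (1 / 8) := by
      gcongr
      exacts [h.mul_le_half, hu.trans hε]
    linarith
  have hone : |1 + u - g| ≤ 5 / 4 := by
    rw [add_sub_assoc]
    refine (abs_add_le _ _).trans ?_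
    rw [abs_one]
    linarith
  have hdrift : |(τ / τ' - 1) * ((1 - η * τ * u) * (1 + u - g))| ≤
      η * τ * ε ^ 2 / 2 * (17 / 16 * (5 / 4)) := by
    rw [abs_mul, abs_mul]
    gcongr
    exact h.abs_ratio_sub_one_le
  have : 0 < η * τ * ε ^ 2 := by have := h.eps_pos; positivity
  linarith [abs_add_le (-(η * τ) * u * (u - g)) ((τ / τ' - 1) * ((1 - η * τ * u) * (1 + u - g)))]

theorem AdmissibleRound.sq_add_remainder_le (h : AdmissibleRound K ε η τ τ') {u g : ℝ}
    (hu : |u| ≤ ε) (hg : |g| ≤ ε) :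
    ((1 - η * τ) * u - g + (-(η * τ) * u * (u - g)
        + (τ / τ' - 1) * ((1 - η * τ * u) * (1 + u - g)))) ^ 2 ≤
      (1 + η * τ / 2) * ((1 - η * τ) * u - g) ^ 2 + 27 * (η * τ) * ε ^ 4 := by
  have hpos := h.mul_pos
  have hrem := sq_le_sq' (neg_le_of_abs_le (h.abs_remainder_le hu hg))
    (le_of_abs_le (h.abs_remainder_le hu hg))
  refine (sq_add_le_add_div_mul_sq hpos (by linarith [h.mul_le_half]) _ _).trans
    (add_le_add_right ?_ _)
  calc _ ≤ 3 / (η * τ) * (3 * (η * τ) * ε ^ 2) ^ 2 :=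
        mul_le_mul_of_nonneg_left hrem (by positivity)
    _ = 27 * (η * τ) * ε ^ 4 := by field_simp; ring

variable {I J : Type*}

/-- The explicit Euler step `x ↦ x (1 - h u)`, of length `h`, of the mirror flow `ẋ = -x u` of the
log-barrier: for the residual `u` at `x` it preserves the simplex. -/
def eulerStep (h : ℝ) (u x : I → ℝ) : I → ℝ := x * (1 - h • u)

variable [Fintype I] [Fintype J]

theorem eulerStep_mem_posSimplex {h : ℝ} (hτ : τ ≠ 0) (F : I → ℝ) {x : I → ℝ}
    (hx : x ∈ posSimplex I) (hu : ∀ i, h * kktResidual τ F x i < 1) :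
    eulerStep h (kktResidual τ F x) x ∈ posSimplex I := by
  refine ⟨fun i => mul_pos (hx.1 i) (sub_pos.2 (hu i)), ?_⟩
  have hterm (i : I) : eulerStep h (kktResidual τ F x) x i =
      x i - h * (x i * kktResidual τ F x i) := by
    simp only [eulerStep, Pi.mul_apply, Pi.sub_apply, Pi.one_apply, Pi.smul_apply, smul_eq_mul]
    ring
  simp only [hterm, sum_sub_distrib, ← mul_sum, sum_mul_kktResidual hτ F hx, hx.2]
  ring

theorem residual_eulerStep_eq (M : Matrix I J ℝ) (hτ : τ ≠ 0) (x : I → ℝ) (q v : J → ℝ) (i : I) :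
    eulerStep (η * τ) (kktResidual τ (M *ᵥ q) x) x i * ((M *ᵥ eulerStep (η * τ) v q) i
        + multiplier τ (M *ᵥ q) x) / τ' - 1 =
      (1 - η * τ) * kktResidual τ (M *ᵥ q) x i - η * (x i * (M *ᵥ (q * v)) i)
        + (-(η * τ) * kktResidual τ (M *ᵥ q) x i
            * (kktResidual τ (M *ᵥ q) x i - η * (x i * (M *ᵥ (q * v)) i))
          + (τ / τ' - 1) * ((1 - η * τ * kktResidual τ (M *ᵥ q) x i)
            * (1 + kktResidual τ (M *ᵥ q) x i - η * (x i * (M *ᵥ (q * v)) i)))) := by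
  have hloss : M *ᵥ eulerStep (η * τ) v q = M *ᵥ q - (η * τ) • M *ᵥ (q * v) := by
    rw [← Matrix.mulVec_smul, ← Matrix.mulVec_sub]
    congr 1
    ext j
    simp only [eulerStep, Pi.mul_apply, Pi.sub_apply, Pi.one_apply, Pi.smul_apply, smul_eq_mul]
    ring
  have hmul := mul_add_multiplier hτ (M *ᵥ q) x i
  rw [hloss]
  simp only [eulerStep, Pi.mul_apply, Pi.sub_apply, Pi.one_apply, Pi.smul_apply, smul_eq_mul]
  linear_combination (1 - η * τ * kktResidual τ (M *ᵥ q) x i) / τ' * hmul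

theorem AdmissibleRound.sum_sq_kktResidual_eulerStep_le (h : AdmissibleRound K ε η τ τ')
    {M : Matrix I J ℝ} (hM : ∀ i j, M i j ∈ Set.Icc (0 : ℝ) 1) {x : I → ℝ} {q v : J → ℝ}
    (hx : x ∈ posSimplex I) (hq : q ∈ posSimplex J) (hu : ∀ i, |kktResidual τ (M *ᵥ q) x i| ≤ ε)
    (hv : ∀ j, |v j| ≤ ε)
    (hx' : eulerStep (η * τ) (kktResidual τ (M *ᵥ q) x) x ∈ posSimplex I) :
    ∑ i, kktResidual τ' (M *ᵥ eulerStep (η * τ) v q)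
        (eulerStep (η * τ) (kktResidual τ (M *ᵥ q) x) x) i ^ 2 ≤
      (1 + η * τ / 2) * ∑ i, ((1 - η * τ) * kktResidual τ (M *ᵥ q) x i
        - η * (x i * (M *ᵥ (q * v)) i)) ^ 2 + Fintype.card I * (27 * (η * τ) * ε ^ 4) := by
  refine (sum_sq_kktResidual_le h.tau_pos'.ne' _ hx' (multiplier τ (M *ᵥ q) x)).trans ?_
  have hg (i : I) : |η * (x i * (M *ᵥ (q * v)) i)| ≤ ε := by
    rw [abs_mul, abs_mul, abs_of_pos h.eta_pos, abs_of_pos (hx.1 i)]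
    exact (mul_le_of_le_one_left (mul_nonneg (hx.1 i).le (abs_nonneg _)) h.eta_le_one).trans
      ((mul_le_of_le_one_left (abs_nonneg _) (le_one_of_mem_posSimplex hx i)).trans
        (abs_mulVec_mul_le hM hq hv i))
  refine (sum_le_sum fun i _ => ?_).trans_eq
    (b := ∑ i, ((1 + η * τ / 2) * ((1 - η * τ) * kktResidual τ (M *ᵥ q) x i
        - η * (x i * (M *ᵥ (q * v)) i)) ^ 2 + 27 * (η * τ) * ε ^ 4)) ?_
  · rw [residual_eulerStep_eq M h.tau_pos.ne']
    exact h.sq_add_remainder_le (hu i) (hg i)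
  · simp [sum_add_distrib, mul_sum]

theorem sum_sq_mul_sub_mul_le {M : Matrix I J ℝ} (hM : ∀ i j, M i j ∈ Set.Icc (0 : ℝ) 1)
    {x : I → ℝ} {q v : J → ℝ} (hx : x ∈ posSimplex I) (hq : q ∈ posSimplex J)
    (hv : ∀ j, |v j| ≤ ε) (s : ℝ) (u : I → ℝ) :
    ∑ i, (s * u i - η * (x i * (M *ᵥ (q * v)) i)) ^ 2 ≤
      s ^ 2 * ∑ i, u i ^ 2 - 2 * s * η * ((x * u) ⬝ᵥ M *ᵥ (q * v)) + η ^ 2 * ε ^ 2 := by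
  have hsq (i : I) : (x i * (M *ᵥ (q * v)) i) ^ 2 ≤ x i * ε ^ 2 := by
    have hle := abs_mulVec_mul_le hM hq hv i
    rw [mul_pow, sq (x i), ← sq_abs ((M *ᵥ (q * v)) i)]
    exact mul_le_mul (mul_le_of_le_one_left (hx.1 i).le (le_one_of_mem_posSimplex hx i))
      (by gcongr) (by positivity) (hx.1 i).le
  have hsum : ∑ i, (x i * (M *ᵥ (q * v)) i) ^ 2 ≤ ε ^ 2 :=
    (sum_le_sum fun i _ => hsq i).trans_eq (by rw [← sum_mul, hx.2, one_mul])
  have hexpand : ∑ i, (s * u i - η * (x i * (M *ᵥ (q * v)) i)) ^ 2 =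
      s ^ 2 * ∑ i, u i ^ 2 - 2 * s * η * ((x * u) ⬝ᵥ M *ᵥ (q * v))
        + η ^ 2 * ∑ i, (x i * (M *ᵥ (q * v)) i) ^ 2 := by
    simp only [dotProduct, mul_sum, ← sum_sub_distrib, ← sum_add_distrib, Pi.mul_apply]
    exact sum_congr rfl fun i _ => by ring
  rw [hexpand]
  gcongr

end EulerStep

section ReferencePath

variable {I J : Type*} [Fintype I] [Fintype J]

/-- The pairs of policies of the game with loss matrix `M` whose residuals for the
`τ`-regularized game have joint Euclidean norm at most `ε`. -/
def residualBall (ε τ : ℝ) (M : Matrix I J ℝ) : Set ((I → ℝ) × (J → ℝ)) :=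
  {z | z.1 ∈ posSimplex I ∧ z.2 ∈ posSimplex J ∧ ∑ i, kktResidual τ (M *ᵥ z.2) z.1 i ^ 2
    + ∑ j, kktResidual τ (opponentLoss M *ᵥ z.1) z.2 j ^ 2 ≤ ε ^ 2}

/-- The simultaneous Euler steps of length `h` of both players, with exact feedback, in the
`τ`-regularized game with loss matrix `M`. -/
def gameStep (h τ : ℝ) (M : Matrix I J ℝ) (z : (I → ℝ) × (J → ℝ)) : (I → ℝ) × (J → ℝ) :=
  (eulerStep h (kktResidual τ (M *ᵥ z.2) z.1) z.1,
    eulerStep h (kktResidual τ (opponentLoss M *ᵥ z.1) z.2) z.2)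

/-- The deterministic path that the policies of the players follow with high probability: the Euler
scheme with exact feedback, started at the uniform policies. -/
def referencePath (η τ : ℕ → ℝ) (M : Matrix I J ℝ) : ℕ → (I → ℝ) × (J → ℝ)
  | 0 => (fun _ => 1 / (Fintype.card I : ℝ), fun _ => 1 / (Fintype.card J : ℝ))
  | t + 1 => gameStep (η t * τ t) (τ t) M (referencePath η τ M t)

variable {M : Matrix I J ℝ} {z : (I → ℝ) × (J → ℝ)} {K ε η τ τ' : ℝ}

theorem swap_mem_residualBall (hz : z ∈ residualBall ε τ M) :
    z.swap ∈ residualBall ε τ (opponentLoss M) := by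
  refine ⟨hz.2.1, hz.1, ?_⟩
  rw [opponentLoss_opponentLoss, add_comm]
  exact hz.2.2

theorem gameStep_swap (h τ : ℝ) (M : Matrix I J ℝ) (z : (I → ℝ) × (J → ℝ)) :
    gameStep h τ (opponentLoss M) z.swap = (gameStep h τ M z).swap := by
  simp [gameStep, opponentLoss_opponentLoss]

theorem abs_kktResidual_le_of_mem_residualBall (hε : 0 ≤ ε) (hz : z ∈ residualBall ε τ M)
    (i : I) : |kktResidual τ (M *ᵥ z.2) z.1 i| ≤ ε := by
  refine abs_le_of_sq_le_sq (le_trans ?_ hz.2.2) hε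
  exact (single_le_sum (f := fun i => kktResidual τ (M *ᵥ z.2) z.1 i ^ 2)
    (fun _ _ => sq_nonneg _) (mem_univ i)).trans
      (le_add_of_nonneg_right (sum_nonneg fun j _ => sq_nonneg _))

theorem AdmissibleRound.eulerStep_mem_posSimplex (h : AdmissibleRound K ε η τ τ')
    (hz : z ∈ residualBall ε τ M) : (gameStep (η * τ) τ M z).1 ∈ posSimplex I := by
  refine _root_.eulerStep_mem_posSimplex h.tau_pos.ne' _ hz.1 fun i => ?_
  have hle := (le_of_abs_le (abs_kktResidual_le_of_mem_residualBall h.eps_pos.le hz i)).trans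
    h.eps_le
  linarith [mul_le_mul_of_nonneg_left hle h.mul_pos.le, h.mul_le_half]

theorem AdmissibleRound.energy_le (h : AdmissibleRound K ε η τ τ') {E : ℝ} (hE : E ≤ ε ^ 2) :
    (1 + η * τ / 2) * ((1 - η * τ) ^ 2 * E + 2 * η ^ 2 * ε ^ 2) + K * (27 * (η * τ) * ε ^ 4) ≤
      ε ^ 2 := by
  have hpos := h.mul_pos
  have hη : 2 * η ^ 2 ≤ η * τ / 2 := by
    linarith [mul_le_mul_of_nonneg_left h.four_mul_eta_le h.eta_pos.le]
  have hmain : (1 + η * τ / 2) * ((1 - η * τ) ^ 2 * E + 2 * η ^ 2 * ε ^ 2) ≤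
      (1 + η * τ / 2) * (((1 - η * τ) ^ 2 + η * τ / 2) * ε ^ 2) := by
    rw [add_mul ((1 - η * τ) ^ 2)]
    gcongr
  have hrem : K * (27 * (η * τ) * ε ^ 4) ≤ 27 / 64 * (η * τ) * ε ^ 2 := by
    have := mul_le_mul_of_nonneg_left h.card_mul_le (b := 64 * K * ε ^ 2)
      (show 0 ≤ 27 / 64 * (η * τ) * ε ^ 2 by positivity)
    linarith
  set s := η * τ
  have hs := h.mul_le_half
  have hfactor : (1 + s / 2) * ((1 - s) ^ 2 + s / 2) + 27 / 64 * s ≤ 1 := by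
    nlinarith [mul_nonneg hpos.le (sub_nonneg.2 hs), mul_nonneg (sq_nonneg s) (sub_nonneg.2 hs)]
  linarith [mul_le_mul_of_nonneg_right hfactor (sq_nonneg ε)]

/-- The cross terms of the two players cancel because the game is zero-sum. -/
theorem AdmissibleRound.gameStep_mem_residualBall
    (h : AdmissibleRound (Fintype.card I + Fintype.card J) ε η τ τ')
    (hM : ∀ i j, M i j ∈ Set.Icc (0 : ℝ) 1) (hz : z ∈ residualBall ε τ M) :
    gameStep (η * τ) τ M z ∈ residualBall ε τ' M := by
  have hz' := swap_mem_residualBall hz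
  have hM' := opponentLoss_mem_Icc hM
  have hx' := h.eulerStep_mem_posSimplex hz
  have hq' : (gameStep (η * τ) τ M z).2 ∈ posSimplex J := by
    simpa only [gameStep_swap, Prod.fst_swap] using h.eulerStep_mem_posSimplex hz'
  refine ⟨hx', hq', ?_⟩
  obtain ⟨x, q⟩ := z
  set u := kktResidual τ (M *ᵥ q) x
  set v := kktResidual τ (opponentLoss M *ᵥ x) q
  have hu (i : I) : |u i| ≤ ε := abs_kktResidual_le_of_mem_residualBall h.eps_pos.le hz i
  have hv (j : J) : |v j| ≤ ε := abs_kktResidual_le_of_mem_residualBall h.eps_pos.le hz' j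
  have hplayer₁ := h.sum_sq_kktResidual_eulerStep_le hM hz.1 hz.2.1 hu hv hx'
  have hplayer₂ := h.sum_sq_kktResidual_eulerStep_le hM' hz.2.1 hz.1 hv hu hq'
  have hexpand₁ := sum_sq_mul_sub_mul_le (η := η) hM hz.1 hz.2.1 hv (1 - η * τ) u
  have hexpand₂ := sum_sq_mul_sub_mul_le (η := η) hM' hz.2.1 hz.1 hu (1 - η * τ) v
  have hskew : (x * u) ⬝ᵥ M *ᵥ (q * v) + (q * v) ⬝ᵥ opponentLoss M *ᵥ (x * u) = 0 := by
    rw [dotProduct_mulVec_add_dotProduct_opponentLoss_mulVec]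
    simp [sum_mul_kktResidual h.tau_pos.ne' _ hz.1, u]
  have hsum := mul_le_mul_of_nonneg_left (add_le_add hexpand₁ hexpand₂)
    (show 0 ≤ 1 + η * τ / 2 by linarith [h.mul_pos])
  have henergy := h.energy_le hz.2.2
  refine (add_le_add hplayer₁ hplayer₂).trans (le_trans ?_ henergy)
  linear_combination hsum - 2 * (1 + η * τ / 2) * (1 - η * τ) * η * hskew

theorem referencePath_mem_residualBall [Nonempty I] [Nonempty J] {η τ : ℕ → ℝ}
    (h : ∀ t, AdmissibleRound (Fintype.card I + Fintype.card J) ε (η t) (τ t) (τ (t + 1)))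
    (hinit : 2 / τ 0 ^ 2 ≤ ε ^ 2) (hM : ∀ i j, M i j ∈ Set.Icc (0 : ℝ) 1) (t : ℕ) :
    referencePath η τ M t ∈ residualBall ε (τ t) M := by
  induction t with
  | zero =>
    refine ⟨const_inv_card_mem_posSimplex, const_inv_card_mem_posSimplex, le_trans ?_ hinit⟩
    have hτ := (h 0).tau_pos.ne'
    have hplayer₁ := sum_sq_kktResidual_const_inv_card_le hτ
      (mulVec_mem_Icc hM const_inv_card_mem_posSimplex)
    have hplayer₂ := sum_sq_kktResidual_const_inv_card_le hτ
      (mulVec_mem_Icc (opponentLoss_mem_Icc hM) const_inv_card_mem_posSimplex)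
    exact (add_le_add hplayer₁ hplayer₂).trans_eq (by ring)
  | succ t ih => exact (h t).gameStep_mem_residualBall hM ih

end ReferencePath

/-! ### Drift of the divergence -/

section Drift

variable {I J : Type*} [Fintype I] [Fintype J]

/-- The bound on the divergence between `x` and the outcome of a regularized mirror step from `w`
with loss estimate `F`, see `IsMirrorStep.itakuraSaito_le_stepBound`. It is affine in `F`, so that
in conditional expectation the estimate is replaced by the loss vector. -/
def stepBound (η τ : ℝ) (x w F : I → ℝ) : ℝ :=
  itakuraSaito x w + η * ((x - w) ⬝ᵥ F) + η * τ * ∑ i, (1 - x i / w i)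
    + (4 * η ^ 2 + 4 * Fintype.card I * (η * τ) ^ 2)

section MirrorStep

variable [DecidableEq I] {η τ ℓ : ℝ} {w w' x : I → ℝ} {a : I}

theorem mul_regularizedEstimate (hw : ∀ i, 0 < w i) (i : I) :
    w i * regularizedEstimate τ w a ℓ i = (if i = a then ℓ else 0) - τ := by
  have := (hw i).ne'
  rw [regularizedEstimate, grad_logBarrier w hw, importanceEstimate]
  split_ifs <;> field_simp <;> ring

theorem sum_regularizedEstimate_mul_sub (hw : ∀ i, 0 < w i) :
    ∑ i, regularizedEstimate τ w a ℓ i * (x i - w i) =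
      (x - w) ⬝ᵥ importanceEstimate w a ℓ + τ * ∑ i, (1 - x i / w i) := by
  rw [dotProduct, mul_sum, ← sum_add_distrib]
  refine sum_congr rfl fun i _ => ?_
  have := (hw i).ne'
  rw [regularizedEstimate, grad_logBarrier w hw, Pi.sub_apply]
  field_simp
  ring

theorem sum_sq_mul_regularizedEstimate_le (hℓ : ℓ ∈ Set.Icc (0 : ℝ) 1) (hw : ∀ i, 0 < w i) :
    ∑ i, (η * (w i * regularizedEstimate τ w a ℓ i)) ^ 2 ≤
      2 * η ^ 2 + 2 * Fintype.card I * (η * τ) ^ 2 := by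
  have hsq : (η * ℓ) ^ 2 ≤ η ^ 2 := by
    rw [mul_pow]
    exact mul_le_of_le_one_right (sq_nonneg η) (pow_le_one₀ hℓ.1 hℓ.2)
  calc _ ≤ ∑ i, ((if i = a then 2 * η ^ 2 else 0) + 2 * (η * τ) ^ 2) := sum_le_sum fun i _ => by
        rw [mul_regularizedEstimate hw]
        split_ifs
        · linarith [sq_nonneg (η * ℓ + η * τ)]
        · linarith [sq_nonneg (η * τ)]
    _ = _ := by
        simp only [sum_add_distrib, sum_ite_eq', mem_univ, if_true, sum_const, card_univ,
          nsmul_eq_mul]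
        ring

theorem IsMirrorStep.itakuraSaito_le_stepBound (hη : 0 ≤ η) (hητ : η * τ ≤ 1 / 2)
    (hℓ : ℓ ∈ Set.Icc (0 : ℝ) 1) (hw : w ∈ posSimplex I)
    (h : IsMirrorStep η (regularizedEstimate τ w a ℓ) w w') (hx : x ∈ posSimplex I) :
    itakuraSaito x w' ≤ stepBound η τ x w (importanceEstimate w a ℓ) := by
  have hmain := h.itakuraSaito_le hw hx fun i => by
    rw [mul_regularizedEstimate hw.1]
    split_ifs
    · linarith [mul_nonneg hη hℓ.1]
    · linarith
  rw [sum_regularizedEstimate_mul_sub hw.1] at hmain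
  unfold stepBound
  linarith [sum_sq_mul_regularizedEstimate_le (η := η) (τ := τ) (a := a) hℓ hw.1]

end MirrorStep

theorem itakuraSaito_eulerStep_le {h : ℝ} {u x y : I → ℝ} (hx : ∀ i, 0 < x i) (hy : ∀ i, 0 < y i)
    (hu : ∀ i, h * u i ≤ 1 / 2) :
    itakuraSaito (eulerStep h u x) y ≤
      itakuraSaito x y + ∑ i, (h * (u i * (1 - x i / y i)) + 2 * (h * u i) ^ 2) := by
  unfold itakuraSaito
  rw [← sum_add_distrib]
  refine sum_le_sum fun i _ => ?_
  have hlog := sub_two_mul_sq_le_log_one_add (g := -(h * u i)) (by linarith [hu i])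
  have hpos : 0 < 1 + -(h * u i) := by linarith [hu i]
  have hratio : eulerStep h u x i / y i = x i / y i * (1 + -(h * u i)) := by
    simp only [eulerStep, Pi.mul_apply, Pi.sub_apply, Pi.one_apply, Pi.smul_apply, smul_eq_mul]
    ring
  rw [hratio, Real.log_mul (div_pos (hx i) (hy i)).ne' hpos.ne']
  linarith

section Coordinate

variable {F F' η τ x y u m : ℝ}

/-- The main term `η (F + m) (y - x)` comes from rewriting the stationarity defect through
`x (F + m) = τ (1 + u)`; only its part along `F` survives summation over the simplex. -/
theorem eulerStep_drift_eq (hx : x ≠ 0) (hy : y ≠ 0) (hu : x * (F + m) = τ * (1 + u)) :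
    η * τ * (u * (1 - x / y)) + η * ((x * (1 - η * τ * u) - y) * F')
        + η * τ * (1 - x * (1 - η * τ * u) / y) =
      η * ((x - y) * (F' - F)) + η * m * (y - x) - η * τ * (1 + u) * ((x - y) ^ 2 / (x * y))
        + (η * τ) ^ 2 * (u * (x / y)) - η * (η * τ) * (x * u * F') := by
  have hmain : η * τ * (1 + u) * (1 - x / y) = η * (F + m) * (y - x)
      - η * τ * (1 + u) * ((x - y) ^ 2 / (x * y)) := by
    have : η * τ * (1 + u) = η * (x * (F + m)) := by rw [hu]; ring
    rw [this]
    field_simp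
    ring
  linear_combination hmain

theorem eulerStep_drift_remainder_le (hη : 0 ≤ η) (hτ : 0 ≤ τ) (hητ : η * τ ≤ 1 / 2) (hx₀ : 0 < x)
    (hx₁ : x ≤ 1) (hy : 0 < y) (hF' : F' ∈ Set.Icc (0 : ℝ) 1) (hu : |u| ≤ 1 / 8) :
    -(η * τ) * (1 + u) * ((x - y) ^ 2 / (x * y)) + (η * τ) ^ 2 * (u * (x / y))
        - η * (η * τ) * (x * u * F') + 2 * (η * τ * u) ^ 2 ≤
      -(η * τ / 2) * ((x - y) ^ 2 / (x * y)) + ((η * τ) ^ 2 / 2 + η * (η * τ) / 8) := by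
  set S := (x - y) ^ 2 / (x * y) with hS_def
  set h := η * τ
  have hh : 0 ≤ h := mul_nonneg hη hτ
  have hS : 0 ≤ S := by positivity
  have hu' := abs_le.1 hu
  have hratio : x / y ≤ S + 2 := by
    have : S + 2 - x / y = y / x := by rw [hS_def]; field_simp; ring
    linarith [div_pos hy hx₀]
  have hcross : h ^ 2 * (u * (x / y)) ≤ h ^ 2 * (1 / 8 * (S + 2)) :=
    mul_le_mul_of_nonneg_left
      (mul_le_mul hu'.2 hratio (div_pos hx₀ hy).le (by norm_num)) (sq_nonneg h)
  have hinteraction : -(x * u * F') ≤ 1 / 8 := by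
    refine (neg_le_abs _).trans ?_
    rw [abs_mul, abs_mul, abs_of_pos hx₀, abs_of_nonneg hF'.1]
    exact (mul_le_of_le_one_right (by positivity) hF'.2).trans
      ((mul_le_of_le_one_left (abs_nonneg u) hx₁).trans hu)
  have hinteraction' : η * h * -(x * u * F') ≤ η * h * (1 / 8) :=
    mul_le_mul_of_nonneg_left hinteraction (mul_nonneg hη hh)
  have hmain : h * (7 / 8) * S ≤ h * (1 + u) * S :=
    mul_le_mul_of_nonneg_right (mul_le_mul_of_nonneg_left (by linarith) hh) hS
  have hquad : h ^ 2 * S ≤ h / 2 * S := by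
    refine mul_le_mul_of_nonneg_right ?_ hS
    linarith [mul_le_mul_of_nonneg_left hητ hh]
  have hsq : h ^ 2 * u ^ 2 ≤ h ^ 2 * (1 / 8) ^ 2 :=
    mul_le_mul_of_nonneg_left (sq_le_sq' hu'.1 hu'.2) (sq_nonneg h)
  linarith [mul_nonneg hh hS, sq_nonneg h]

end Coordinate

variable {η τ : ℝ}

theorem stepBound_eulerStep_le (hη : 0 < η) (hτ : 0 < τ) (hητ : η * τ ≤ 1 / 2)
    {F F' x y : I → ℝ} (hx : x ∈ posSimplex I) (hy : y ∈ posSimplex I)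
    (hF' : ∀ i, F' i ∈ Set.Icc (0 : ℝ) 1) (hu : ∀ i, |kktResidual τ F x i| ≤ 1 / 8) :
    stepBound η τ (eulerStep (η * τ) (kktResidual τ F x) x) y F' ≤
      (1 - η * τ / 2) * itakuraSaito x y + η * ((x - y) ⬝ᵥ (F' - F))
        + 5 * Fintype.card I * (η ^ 2 + (η * τ) ^ 2) := by
  set u := kktResidual τ F x
  set m := multiplier τ F x
  have hητ₀ := mul_pos hη hτ
  have heuler := itakuraSaito_eulerStep_le (h := η * τ) (u := u) hx.1 hy.1 fun i => by
    linarith [mul_le_mul_of_nonneg_left ((le_abs_self _).trans (hu i)) hητ₀.le]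
  have hcoord (i : I) : η * τ * (u i * (1 - x i / y i)) + 2 * (η * τ * u i) ^ 2
      + η * ((x i * (1 - η * τ * u i) - y i) * F' i)
      + η * τ * (1 - x i * (1 - η * τ * u i) / y i) ≤
      η * ((x i - y i) * (F' i - F i)) + η * m * (y i - x i)
        - η * τ / 2 * ((x i - y i) ^ 2 / (x i * y i)) + ((η * τ) ^ 2 / 2 + η * (η * τ) / 8) := by
    have heq := eulerStep_drift_eq (η := η) (F' := F' i) (hx.1 i).ne' (hy.1 i).ne'
      (mul_add_multiplier hτ.ne' F x i)
    have hle := eulerStep_drift_remainder_le hη.le hτ.le hητ (hx.1 i)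
      (le_one_of_mem_posSimplex hx i) (hy.1 i) (hF' i) (hu i)
    linarith
  have hsum := sum_le_sum fun i (_ : i ∈ univ) => hcoord i
  simp only [sum_add_distrib, sum_sub_distrib, ← mul_sum, hx.2, hy.2, sub_self, mul_zero,
    sum_const, card_univ, nsmul_eq_mul] at hsum heuler
  have hdiv := mul_le_mul_of_nonneg_left (itakuraSaito_le_sum_sq_div_mul hx.1 hy.1)
    (show 0 ≤ η * τ / 2 by positivity)
  have hcard : (1 : ℝ) ≤ Fintype.card I :=
    have := nonempty_of_mem_posSimplex hx
    mod_cast Fintype.card_pos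
  have hyoung : η * (η * τ) ≤ (η ^ 2 + (η * τ) ^ 2) / 2 := by
    linarith [two_mul_le_add_sq η (η * τ)]
  have hconst := mul_le_mul_of_nonneg_left hyoung (zero_le_one.trans hcard)
  have hη_sq := mul_le_mul_of_nonneg_right hcard (sq_nonneg η)
  have hητ_sq : 0 ≤ (Fintype.card I : ℝ) * (η * τ) ^ 2 := by positivity
  simp only [stepBound, dotProduct, eulerStep, Pi.mul_apply, Pi.sub_apply, Pi.one_apply,
    Pi.smul_apply, smul_eq_mul, sum_sub_distrib, sum_const, card_univ, nsmul_eq_mul]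
    at heuler ⊢
  linarith [sq_nonneg η]

/-- The sum of the Itakura–Saito divergences of the two players. -/
def jointDivergence (z w : (I → ℝ) × (J → ℝ)) : ℝ := itakuraSaito z.1 w.1 + itakuraSaito z.2 w.2

theorem AdmissibleRound.stepBound_gameStep_add_le {K ε τ' : ℝ}
    (h : AdmissibleRound K ε η τ τ') {M : Matrix I J ℝ} (hM : ∀ i j, M i j ∈ Set.Icc (0 : ℝ) 1)
    {z w : (I → ℝ) × (J → ℝ)} (hz : z ∈ residualBall ε τ M) (hw₁ : w.1 ∈ posSimplex I)
    (hw₂ : w.2 ∈ posSimplex J) :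
    stepBound η τ (gameStep (η * τ) τ M z).1 w.1 (M *ᵥ w.2)
        + stepBound η τ (gameStep (η * τ) τ M z).2 w.2 (opponentLoss M *ᵥ w.1) ≤
      (1 - η * τ / 2) * jointDivergence z w
        + 5 * (Fintype.card I + Fintype.card J) * (η ^ 2 + (η * τ) ^ 2) := by
  have hplayer₁ := stepBound_eulerStep_le h.eta_pos h.tau_pos h.mul_le_half hz.1 hw₁
    (mulVec_mem_Icc hM hw₂)
    fun i => (abs_kktResidual_le_of_mem_residualBall h.eps_pos.le hz i).trans h.eps_le
  have hplayer₂ := stepBound_eulerStep_le h.eta_pos h.tau_pos h.mul_le_half hz.2.1 hw₂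
    (mulVec_mem_Icc (opponentLoss_mem_Icc hM) hw₁)
    fun j => (abs_kktResidual_le_of_mem_residualBall h.eps_pos.le
      (swap_mem_residualBall hz) j).trans h.eps_le
  have hskew := dotProduct_mulVec_add_dotProduct_opponentLoss_mulVec M (w.1 - z.1) (w.2 - z.2)
  have hzero : ∑ i, (w.1 - z.1) i = 0 := by simp [hw₁.2, hz.1.2]
  rw [hzero, zero_mul, Matrix.mulVec_sub, Matrix.mulVec_sub, ← neg_sub z.1, ← neg_sub z.2,
    neg_dotProduct, neg_dotProduct] at hskew
  rw [Prod.snd_swap] at hplayer₂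
  unfold jointDivergence gameStep
  linear_combination hplayer₁ + hplayer₂ - η * hskew

end Drift

/-! ### From the divergence to the exploitability gap -/

section Exploitability

variable {I J : Type*} [Fintype I] [Fintype J]

theorem dotProduct_mulVec_sub_dotProduct_mulVec_le {M : Matrix I J ℝ}
    (hM : ∀ i j, M i j ∈ Set.Icc (0 : ℝ) 1) {τ ε : ℝ} (hτ : 0 < τ) (hε : ε ≤ 1) {x x' : I → ℝ}
    {q z : J → ℝ} (hx : x ∈ posSimplex I) (hu : ∀ i, |kktResidual τ (M *ᵥ q) x i| ≤ ε)
    (hx' : x' ∈ stdSimplex ℝ I) :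
    x ⬝ᵥ M *ᵥ q - x' ⬝ᵥ M *ᵥ z ≤ τ * (Fintype.card I * (1 + ε)) + ∑ j, |q j - z j| := by
  have haction (i : I) : x ⬝ᵥ M *ᵥ q - (M *ᵥ z) i ≤
      τ * (Fintype.card I * (1 + ε)) + ∑ j, |q j - z j| := by
    have hbest := dotProduct_sub_le_of_abs_kktResidual_le hτ hε (M *ᵥ q) hx hu i
    have hclose := (le_abs_self _).trans (abs_mulVec_le hM (q - z) i)
    simp only [Matrix.mulVec_sub, Pi.sub_apply] at hclose
    linarith
  have hmix := sum_le_sum fun i (_ : i ∈ univ) => mul_le_mul_of_nonneg_left (haction i) (hx'.1 i)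
  simpa only [mul_sub, sum_sub_distrib, ← sum_mul, hx'.2, one_mul, dotProduct] using hmix

theorem posSimplex_subset_stdSimplex : posSimplex I ⊆ stdSimplex ℝ I :=
  fun _ hx => ⟨fun i => (hx.1 i).le, hx.2⟩

namespace MatrixGame

variable {A B : Type*}

/-- The loss matrix of the min-player, with entries `ℓ(a, b)`. -/
def lossMatrix (G : MatrixGame A B) : Matrix A B ℝ := Matrix.of G.meanLoss

theorem lossMatrix_mem_Icc (G : MatrixGame A B) (a : A) (b : B) :
    G.lossMatrix a b ∈ Set.Icc (0 : ℝ) 1 := by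
  refine ⟨integral_nonneg fun x => x.2.1, ?_⟩
  have hle := integral_mono_of_nonneg (μ := (G.law a b : Measure unitInterval))
    (f := fun x => (x : ℝ)) (g := fun _ => (1 : ℝ)) (.of_forall fun x => x.2.1)
    (integrable_const _) (.of_forall fun x => x.2.2)
  simpa [lossMatrix, meanLoss] using hle

variable [Fintype A] [Fintype B]

theorem expectedLoss_eq_dotProduct_mulVec (G : MatrixGame A B) (μ : A → ℝ) (ν : B → ℝ) :
    G.expectedLoss μ ν = μ ⬝ᵥ G.lossMatrix *ᵥ ν := by
  simp only [expectedLoss, dotProduct, Matrix.mulVec, lossMatrix, Matrix.of_apply, mul_sum]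
  exact sum_congr rfl fun a _ => sum_congr rfl fun b _ => by ring

theorem expectedLoss_add_dotProduct_opponentLoss_mulVec (G : MatrixGame A B) {μ : A → ℝ}
    {ν : B → ℝ} (hμ : ∑ a, μ a = 1) (hν : ∑ b, ν b = 1) :
    G.expectedLoss μ ν + ν ⬝ᵥ opponentLoss G.lossMatrix *ᵥ μ = 1 := by
  rw [expectedLoss_eq_dotProduct_mulVec, dotProduct_mulVec_add_dotProduct_opponentLoss_mulVec,
    hμ, hν, one_mul]

theorem expectedLoss_mem_Icc (G : MatrixGame A B) {μ : A → ℝ} {ν : B → ℝ}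
    (hμ : μ ∈ stdSimplex ℝ A) (hν : ν ∈ stdSimplex ℝ B) :
    G.expectedLoss μ ν ∈ Set.Icc (0 : ℝ) 1 := by
  refine ⟨sum_nonneg fun a _ => sum_nonneg fun b _ =>
    mul_nonneg (mul_nonneg (hμ.1 a) (hν.1 b)) (G.lossMatrix_mem_Icc a b).1, ?_⟩
  calc G.expectedLoss μ ν ≤ ∑ a, ∑ b, μ a * ν b := sum_le_sum fun a _ => sum_le_sum fun b _ =>
        mul_le_of_le_one_right (mul_nonneg (hμ.1 a) (hν.1 b)) (G.lossMatrix_mem_Icc a b).2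
    _ = 1 := by simp only [← mul_sum, hμ.2, hν.2, mul_one]

variable [Nonempty A] [Nonempty B] {μ : A → ℝ} {ν : B → ℝ}

theorem exploitabilityGap_le_of_forall (G : MatrixGame A B) {r : ℝ}
    (h : ∀ μ' ∈ stdSimplex ℝ A, ∀ ν' ∈ stdSimplex ℝ B,
      G.expectedLoss μ ν' - G.expectedLoss μ' ν ≤ r) : G.exploitabilityGap μ ν ≤ r := by
  have : Nonempty (stdSimplex ℝ A) :=
    ⟨⟨_, posSimplex_subset_stdSimplex const_inv_card_mem_posSimplex⟩⟩
  have : Nonempty (stdSimplex ℝ B) :=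
    ⟨⟨_, posSimplex_subset_stdSimplex const_inv_card_mem_posSimplex⟩⟩
  refine sub_le_iff_le_add.2 (ciSup_le fun ν' => ?_)
  refine sub_le_iff_le_add'.1 (le_ciInf fun μ' => ?_)
  exact sub_le_comm.1 (h _ μ'.2 _ ν'.2)

theorem exploitabilityGap_le_one (G : MatrixGame A B) (hμ : μ ∈ stdSimplex ℝ A)
    (hν : ν ∈ stdSimplex ℝ B) : G.exploitabilityGap μ ν ≤ 1 :=
  G.exploitabilityGap_le_of_forall fun _ hμ' _ hν' => by
    linarith [(G.expectedLoss_mem_Icc hμ hν').2, (G.expectedLoss_mem_Icc hμ' hν).1]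

theorem exploitabilityGap_le_of_mem_residualBall (G : MatrixGame A B) {τ ε d : ℝ} (hτ : 0 < τ)
    (hε₀ : 0 ≤ ε) (hε₁ : ε ≤ 1) {z : (A → ℝ) × (B → ℝ)} (hz : z ∈ residualBall ε τ G.lossMatrix)
    (hμ : ∑ a, |z.1 a - μ a| ≤ d) (hν : ∑ b, |z.2 b - ν b| ≤ d) (hμ_sum : ∑ a, μ a = 1) :
    G.exploitabilityGap μ ν ≤
      τ * ((Fintype.card A + Fintype.card B) * (1 + ε)) + 2 * d := by
  refine G.exploitabilityGap_le_of_forall fun μ' hμ' ν' hν' => ?_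
  have hmin := dotProduct_mulVec_sub_dotProduct_mulVec_le G.lossMatrix_mem_Icc hτ hε₁ (z := ν)
    hz.1 (abs_kktResidual_le_of_mem_residualBall hε₀ hz) hμ'
  have hmax := dotProduct_mulVec_sub_dotProduct_mulVec_le
    (opponentLoss_mem_Icc G.lossMatrix_mem_Icc) hτ hε₁ (z := μ) hz.2.1
    (abs_kktResidual_le_of_mem_residualBall hε₀ (swap_mem_residualBall hz)) hν'
  have hvalue := G.expectedLoss_add_dotProduct_opponentLoss_mulVec hz.1.2 hz.2.1.2
  have hdeviate := G.expectedLoss_add_dotProduct_opponentLoss_mulVec hμ_sum hν'.2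
  rw [← expectedLoss_eq_dotProduct_mulVec, ← expectedLoss_eq_dotProduct_mulVec] at hmin
  rw [Prod.snd_swap] at hmax
  linarith

theorem exploitabilityGap_le_of_jointDivergence_le (G : MatrixGame A B) {τ ε : ℝ} (hτ : 0 < τ)
    (hε₀ : 0 ≤ ε) (hε₁ : ε ≤ 1 / 8) {z : (A → ℝ) × (B → ℝ)}
    (hz : z ∈ residualBall ε τ G.lossMatrix) (hμ : μ ∈ posSimplex A) (hν : ν ∈ posSimplex B)
    (hdiv : jointDivergence z (μ, ν) ≤ τ ^ 2 / 16) :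
    G.exploitabilityGap μ ν ≤ 2 * (Fintype.card A + Fintype.card B) * τ := by
  have hA : (1 : ℝ) ≤ Fintype.card A := mod_cast Fintype.card_pos
  have hB : (1 : ℝ) ≤ Fintype.card B := mod_cast Fintype.card_pos
  have hcard : 2 * τ ≤ (Fintype.card A + Fintype.card B) * τ := by gcongr; linarith
  rcases le_total τ 1 with hτ₁ | hτ₁
  · have hdiv₁ := itakuraSaito_nonneg hz.1.1 hμ.1
    have hdiv₂ := itakuraSaito_nonneg hz.2.1.1 hν.1
    simp only [jointDivergence] at hdiv
    have hμ_close := sum_abs_sub_le_of_itakuraSaito_le_sq (d := τ / 4) hz.1.1 hμ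
      (by linarith) (by linarith) (by linarith)
    have hν_close := sum_abs_sub_le_of_itakuraSaito_le_sq (d := τ / 4) hz.2.1.1 hν
      (by linarith) (by linarith) (by linarith)
    refine (G.exploitabilityGap_le_of_mem_residualBall hτ hε₀ (by linarith) hz hμ_close hν_close
      hμ.2).trans ?_
    linarith [mul_le_mul_of_nonneg_left hε₁
      (show 0 ≤ (Fintype.card A + Fintype.card B) * τ by positivity)]
  · refine (G.exploitabilityGap_le_one (posSimplex_subset_stdSimplex hμ)
      (posSimplex_subset_stdSimplex hν)).trans ?_
    linarith

end MatrixGame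

end Exploitability

/-! ### Parameters -/

section Schedule

/-- The properties of the learning rates `η` and of the regularization strengths `τ` from which the
bound on the exploitability gap follows: `K` is the number of actions of both players, `δ` the
probability of failure, and `ε` the radius of the ball which contains the residuals of the reference
path. -/
structure AdmissibleSchedule (K δ ε : ℝ) (η τ : ℕ → ℝ) : Prop where
  round : ∀ t, AdmissibleRound K ε (η t) (τ t) (τ (t + 1))
  init_le : 2 / τ 0 ^ 2 ≤ ε ^ 2
  contraction : ∀ t, (1 - η t * τ t / 2) * τ t ^ 2 ≤ τ (t + 1) ^ 2
  budget : ∀ n, ∑ t ∈ range n, 80 * K * (η t ^ 2 + (η t * τ t) ^ 2) / τ (t + 1) ^ 2 ≤ δ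

section Scalar

variable {s δ : ℝ}

theorem log_add_one_div_eq (hs : 0 < s) (hδ : 0 < δ) :
    Real.log ((s + 1) / δ) = Real.log (s / δ) + Real.log ((s + 1) / s) := by
  rw [← Real.log_mul (by positivity) (by positivity)]
  congr 1
  field_simp

theorem log_add_one_div_le (hs : 0 < s) (hδ : 0 < δ) :
    Real.log ((s + 1) / δ) ≤ Real.log (s / δ) + 1 / s := by
  have := Real.log_le_sub_one_of_pos (x := (s + 1) / s) (by positivity)
  have : (s + 1) / s - 1 = 1 / s := by field_simp; ring
  linarith [log_add_one_div_eq hs hδ]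

theorem le_log_add_one_div (hs : 0 < s) (hδ : 0 < δ) :
    Real.log (s / δ) + 1 / (s + 1) ≤ Real.log ((s + 1) / δ) := by
  have := Real.one_sub_inv_le_log_of_pos (x := (s + 1) / s) (by positivity)
  have : 1 - ((s + 1) / s)⁻¹ = 1 / (s + 1) := by field_simp; ring
  linarith [log_add_one_div_eq hs hδ]

theorem log_div_log_add_one_mem_Icc (hs : 1 ≤ s) (hδ : 0 < δ) (hlog : 1 ≤ Real.log (s / δ)) :
    Real.log (s / δ) / Real.log ((s + 1) / δ) ∈ Set.Icc (1 - 1 / s) 1 := by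
  have hs₀ : 0 < s := by linarith
  have hinv : 0 < 1 / (s + 1) := by positivity
  have hmono := le_log_add_one_div hs₀ hδ
  have hincr := log_add_one_div_le hs₀ hδ
  have hpos : 0 < Real.log ((s + 1) / δ) := by linarith
  refine ⟨?_, (div_le_one hpos).2 (by linarith)⟩
  rw [le_div_iff₀ hpos]
  have hs₁ : 1 / s ≤ 1 := (div_le_one hs₀).2 hs
  have hinv' : 0 < 1 / s := by positivity
  linarith [mul_le_mul_of_nonneg_left hincr (sub_nonneg.2 hs₁),
    mul_le_mul_of_nonneg_left hlog hinv'.le, mul_pos hinv' hinv']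

theorem rpow_neg_div_rpow_add_one_neg_mem_Icc {p : ℝ} (hs : 0 < s) (hp₀ : 0 ≤ p) (hp₁ : p ≤ 1) :
    s ^ (-p) / (s + 1) ^ (-p) ∈ Set.Icc 1 (1 + 1 / s) := by
  have hbase : 1 ≤ 1 + 1 / s := le_add_of_nonneg_right (by positivity)
  have : s ^ (-p) / (s + 1) ^ (-p) = (1 + 1 / s) ^ p := by
    rw [Real.rpow_neg hs.le, Real.rpow_neg (by positivity), inv_div_inv,
      ← Real.div_rpow (by positivity) hs.le, add_div, div_self hs.ne']
  rw [this]
  exact ⟨Real.one_le_rpow hbase hp₀, Real.rpow_le_self_of_one_le hbase hp₁⟩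

theorem log_div_div_le {s' : ℝ} (hs : 0 < s) (hδ : 0 < δ) (hlog : 1 ≤ Real.log (s / δ))
    (hss' : s ≤ s') : Real.log (s' / δ) / s' ≤ Real.log (s / δ) / s := by
  have : 0 < s' := hs.trans_le hss'
  have hdiv : s / δ ≤ s' / δ := by gcongr
  have hmem : Real.exp 1 ≤ s / δ := (Real.le_log_iff_exp_le (div_pos hs hδ)).1 hlog
  have hanti := Real.log_div_self_antitoneOn hmem (hmem.trans hdiv) hdiv
  simp only [div_div_eq_mul_div, mul_div_right_comm] at hanti
  exact le_of_mul_le_mul_right hanti hδ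

theorem one_div_mul_sq_log_le (hs : 1 ≤ s) (hδ : 0 < δ) (hlog : 1 ≤ Real.log (s / δ)) :
    1 / (s * Real.log (s / δ) ^ 2) ≤
      4 * (1 / Real.log (s / δ) - 1 / Real.log ((s + 1) / δ)) := by
  have hs₀ : 0 < s := by linarith
  have hlower := le_log_add_one_div hs₀ hδ
  have hupper := log_add_one_div_le hs₀ hδ
  set l := Real.log (s / δ)
  set l' := Real.log ((s + 1) / δ)
  have hinv : 0 < 1 / (s + 1) := by positivity
  have hhalf : 1 / (2 * s) ≤ 1 / (s + 1) := one_div_le_one_div_of_le (by linarith) (by linarith)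
  have hdouble : l' ≤ 2 * l := by linarith [(div_le_one hs₀).2 hs]
  have : 0 < l := by linarith
  have hl' : 0 < l' := by linarith
  have hincr : 0 ≤ l' - l := by linarith
  calc 1 / (s * l ^ 2) = 4 * (1 / (2 * s) / (l * (2 * l))) := by field_simp; norm_num
    _ ≤ 4 * ((l' - l) / (l * l')) := by gcongr; linarith
    _ = 4 * (1 / l - 1 / l') := by field_simp

theorem one_div_mul_sqrt_le (hs : 1 ≤ s) : 1 / (s * √s) ≤ 4 * (1 / √s - 1 / √(s + 1)) := by
  have : 0 < √s := Real.sqrt_pos.2 (by linarith)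
  have hb : 0 < √(s + 1) := Real.sqrt_pos.2 (by linarith)
  have ha_sq : √s ^ 2 = s := Real.sq_sqrt (by linarith)
  have hb_sq : √(s + 1) ^ 2 = s + 1 := Real.sq_sqrt (by linarith)
  have hab : √s ≤ √(s + 1) := Real.sqrt_le_sqrt (by linarith)
  calc 1 / (s * √s) = 4 * (1 / (√s * (4 * √s ^ 2))) := by rw [ha_sq]; field_simp
    _ ≤ 4 * (1 / (√s * (√(s + 1) * (√(s + 1) + √s)))) := by
        have : √(s + 1) * (√(s + 1) + √s) ≤ 4 * √s ^ 2 := by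
          linarith [mul_le_mul_of_nonneg_left hab hb.le]
        gcongr 4 * (1 / (√s * ?_))
    _ = 4 * (1 / √s - 1 / √(s + 1)) := by
        field_simp
        linarith

end Scalar

/-- The quantitative consequences of `ParameterCondition` for a constant that is small in terms of
the number `K` of actions of both players and of `δ`. -/
structure ParameterBounds (K δ η τ : ℝ) (T₀ : ℕ) : Prop where
  one_le_card : 1 ≤ K
  delta_pos : 0 < δ
  delta_lt_one : δ < 1
  eta_pos : 0 < η
  eta_le : 3200 * K * η ≤ δ
  one_le_tau : 1 ≤ τ
  card_le_mul : 256 * K ≤ η * τ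
  one_le_horizon : (1 : ℝ) ≤ T₀
  le_log : 128 * K * (1 + Real.log (1 / δ)) ≤ Real.log T₀
  mul_le : η * τ ≤ T₀ / Real.log T₀ ^ 4
  le_pow : (T₀ : ℝ) ≤ Real.log (1 / δ) ^ 2 * τ ^ 4

/-- The constant `c(K, δ)`: its exponential part forces `T₀` to be large, because
`1 / c ≤ η τ ≤ T₀ / (log T₀) ^ 4`. -/
def parameterConstant (K δ : ℝ) : ℝ :=
  min (Real.exp (-(128 * K * (1 + Real.log (1 / δ)))) / 17) (δ / (3200 * K))

theorem parameterConstant_pos {K δ : ℝ} (hK : 0 < K) (hδ : 0 < δ) : 0 < parameterConstant K δ :=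
  lt_min (by positivity) (by positivity)

theorem ParameterCondition.le_log {c δ η τ Q : ℝ} {T₀ : ℕ} (h : ParameterCondition c δ η τ T₀)
    (hc : 0 < c) (hcQ : c < Real.exp (-Q) / 16) : Q ≤ Real.log T₀ := by
  by_contra! hlt
  have hT₀ : (2 : ℝ) ≤ T₀ := mod_cast h.two_le
  have hT₀_lt : (T₀ : ℝ) < Real.exp Q := (Real.log_lt_iff_lt_exp (by linarith)).1 hlt
  have hlog : 1 / 2 ≤ Real.log T₀ := by
    linarith [Real.log_le_log two_pos hT₀, Real.log_two_gt_d9]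
  have hbound : η * τ ≤ Real.exp Q / (1 / 2) ^ 4 := h.mul_le.trans (by gcongr)
  have hle : 1 ≤ c * (η * τ) := (div_le_iff₀ (mul_pos h.eta_pos h.tau_pos)).1 h.inv_le
  refine hle.not_gt ?_
  calc c * (η * τ) ≤ c * (Real.exp Q / (1 / 2) ^ 4) := by gcongr
    _ < Real.exp (-Q) / 16 * (Real.exp Q / (1 / 2) ^ 4) := by gcongr
    _ = 1 := by rw [Real.exp_neg]; field_simp; norm_num

theorem ParameterCondition.parameterBounds {K δ η τ : ℝ} {T₀ : ℕ} (hK : 1 ≤ K) (hδ₀ : 0 < δ)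
    (hδ₁ : δ < 1) (h : ParameterCondition (parameterConstant K δ) δ η τ T₀) :
    ParameterBounds K δ η τ T₀ := by
  have hη := h.eta_pos
  have hητ := mul_pos hη h.tau_pos
  have hc₀ := parameterConstant_pos (zero_lt_one.trans_le hK) hδ₀
  have hcδ : 3200 * K * parameterConstant K δ ≤ δ :=
    (le_div_iff₀' (by positivity)).1 (min_le_right _ _)
  have hηδ : 3200 * K * η ≤ δ := le_trans (by gcongr; exact h.eta_le) hcδ
  have hmul : 256 * K ≤ η * τ := by
    have hinv : 1 ≤ parameterConstant K δ * (η * τ) := (div_le_iff₀ hητ).1 h.inv_le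
    have := mul_le_mul_of_nonneg_left hinv (show 0 ≤ 3200 * K by linarith)
    have := mul_le_mul_of_nonneg_right (hcδ.trans hδ₁.le) hητ.le
    linarith
  have hη₁ : η ≤ 1 := by linarith [mul_le_mul_of_nonneg_right hK hη.le]
  refine ⟨hK, hδ₀, hδ₁, hη, hηδ, ?_, hmul, mod_cast one_le_two.trans h.two_le, ?_, h.mul_le,
    h.le_pow⟩
  · linarith [mul_le_mul_of_nonneg_right hη₁ h.tau_pos.le]
  · refine h.le_log hc₀ ((min_le_left _ _).trans_lt ?_)
    gcongr
    norm_num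

end Schedule

section Parameters

namespace ParameterBounds

variable {K δ η τ : ℝ} {T₀ : ℕ}

theorem one_le_time (h : ParameterBounds K δ η τ T₀) (t : ℕ) : (1 : ℝ) ≤ t + T₀ :=
  h.one_le_horizon.trans (le_add_of_nonneg_left t.cast_nonneg)

theorem log_one_div_pos (h : ParameterBounds K δ η τ T₀) : 0 < Real.log (1 / δ) :=
  Real.log_pos ((one_lt_div h.delta_pos).2 h.delta_lt_one)

theorem le_log_div (h : ParameterBounds K δ η τ T₀) (t : ℕ) :
    128 * K * (1 + Real.log (1 / δ)) ≤ Real.log ((t + T₀) / δ) := by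
  have hT₀ := zero_lt_one.trans_le h.one_le_horizon
  refine h.le_log.trans (Real.log_le_log hT₀ ?_)
  rw [le_div_iff₀ h.delta_pos]
  exact (mul_le_of_le_one_right hT₀.le h.delta_lt_one.le).trans
    (le_add_of_nonneg_left t.cast_nonneg)

theorem one_le_log_div (h : ParameterBounds K δ η τ T₀) (t : ℕ) :
    1 ≤ Real.log ((t + T₀) / δ) := by
  have := mul_nonneg (zero_le_one.trans h.one_le_card) h.log_one_div_pos.le
  linarith [h.le_log_div t, h.one_le_card, h.log_one_div_pos]

theorem eta_le_one (h : ParameterBounds K δ η τ T₀) : 3200 * η ≤ 1 := by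
  linarith [mul_le_mul_of_nonneg_right h.one_le_card h.eta_pos.le, h.eta_le, h.delta_lt_one]

theorem tau_pos (h : ParameterBounds K δ η τ T₀) : 0 < τ := zero_lt_one.trans_le h.one_le_tau

theorem learningRate_pos (h : ParameterBounds K δ η τ T₀) (t : ℕ) : 0 < learningRate η T₀ t :=
  mul_pos h.eta_pos (Real.rpow_pos_of_pos (zero_lt_one.trans_le (h.one_le_time t)) _)

theorem regStrength_pos (h : ParameterBounds K δ η τ T₀) (t : ℕ) : 0 < regStrength τ δ T₀ t :=
  mul_pos (mul_pos h.tau_pos (zero_lt_one.trans_le (h.one_le_log_div t)))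
    (Real.rpow_pos_of_pos (zero_lt_one.trans_le (h.one_le_time t)) _)

theorem learningRate_mul_regStrength (h : ParameterBounds K δ η τ T₀) (t : ℕ) :
    learningRate η T₀ t * regStrength τ δ T₀ t =
      η * τ * (Real.log ((t + T₀) / δ) / (t + T₀)) := by
  have hs := zero_lt_one.trans_le (h.one_le_time t)
  have hpow : ((t : ℝ) + T₀) ^ (-(3 / 4) : ℝ) * ((t : ℝ) + T₀) ^ (-(1 / 4) : ℝ) =
      ((t : ℝ) + T₀)⁻¹ := by
    rw [← Real.rpow_add hs, ← Real.rpow_neg_one]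
    norm_num
  rw [learningRate, regStrength, div_eq_mul_inv (Real.log _), ← hpow]
  ring

theorem card_div_le_learningRate_mul_regStrength (h : ParameterBounds K δ η τ T₀) (t : ℕ) :
    256 * K * (1 / (t + T₀)) ≤ learningRate η T₀ t * regStrength τ δ T₀ t := by
  have hs := zero_lt_one.trans_le (h.one_le_time t)
  rw [h.learningRate_mul_regStrength]
  exact mul_le_mul h.card_le_mul (div_le_div_of_nonneg_right (h.one_le_log_div t) hs.le)
    (by positivity) (mul_pos h.eta_pos h.tau_pos).le

theorem sq_learningRate (h : ParameterBounds K δ η τ T₀) (t : ℕ) :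
    learningRate η T₀ t ^ 2 = η ^ 2 * (1 / ((t + T₀) * √(t + T₀))) := by
  have hs := zero_lt_one.trans_le (h.one_le_time t)
  rw [learningRate, mul_pow, ← Real.rpow_mul_natCast hs.le, Real.sqrt_eq_rpow,
    ← Real.rpow_one_add' hs.le (by norm_num), one_div, ← Real.rpow_neg hs.le]
  norm_num

theorem sq_regStrength (h : ParameterBounds K δ η τ T₀) (t : ℕ) :
    regStrength τ δ T₀ t ^ 2 = τ ^ 2 * Real.log ((t + T₀) / δ) ^ 2 / √(t + T₀) := by
  have hs := zero_lt_one.trans_le (h.one_le_time t)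
  rw [regStrength, mul_pow, mul_pow, ← Real.rpow_mul_natCast hs.le, Real.sqrt_eq_rpow,
    div_eq_mul_inv _ (_ ^ (1 / 2 : ℝ)), ← Real.rpow_neg hs.le]
  norm_num

theorem regStrength_div_mem_Icc (h : ParameterBounds K δ η τ T₀) (t : ℕ) :
    regStrength τ δ T₀ t / regStrength τ δ T₀ (t + 1) ∈
      Set.Icc (1 - 1 / ((t : ℝ) + T₀)) (1 + 1 / (t + T₀)) := by
  have hs := h.one_le_time t
  have hs₀ := zero_lt_one.trans_le hs
  have hlog := log_div_log_add_one_mem_Icc hs h.delta_pos (h.one_le_log_div t)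
  have hpow := rpow_neg_div_rpow_add_one_neg_mem_Icc (p := 1 / 4) hs₀ (by norm_num) (by norm_num)
  have hratio : regStrength τ δ T₀ t / regStrength τ δ T₀ (t + 1) =
      Real.log ((t + T₀) / δ) / Real.log ((t + T₀ + 1) / δ)
        * (((t : ℝ) + T₀) ^ (-(1 / 4) : ℝ) / ((t : ℝ) + T₀ + 1) ^ (-(1 / 4) : ℝ)) := by
    have := h.tau_pos.ne'
    rw [regStrength, regStrength, Nat.cast_succ, add_right_comm]
    field_simp
  have hnonneg : 0 ≤ 1 - 1 / ((t : ℝ) + T₀) := sub_nonneg.2 ((div_le_one hs₀).2 hs)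
  rw [hratio]
  constructor
  · exact hlog.1.trans (le_mul_of_one_le_right (hnonneg.trans hlog.1) hpow.1)
  · exact (mul_le_of_le_one_left (zero_le_one.trans hpow.1) hlog.2).trans hpow.2

theorem learningRate_mul_regStrength_le_half (h : ParameterBounds K δ η τ T₀) (t : ℕ) :
    learningRate η T₀ t * regStrength τ δ T₀ t ≤ 1 / 2 := by
  have hT₀ := zero_lt_one.trans_le h.one_le_horizon
  have hδ := h.log_one_div_pos
  have hlog_div : Real.log (T₀ / δ) = Real.log T₀ + Real.log (1 / δ) := by
    rw [← Real.log_mul hT₀.ne' (one_div_pos.2 h.delta_pos).ne', mul_one_div]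
  have hlog : 128 * (1 + Real.log (1 / δ)) ≤ Real.log T₀ := by
    linarith [mul_le_mul_of_nonneg_right h.one_le_card (add_pos one_pos hδ).le, h.le_log]
  have hdecay : Real.log ((t + T₀) / δ) / (t + T₀) ≤ Real.log (T₀ / δ) / T₀ :=
    log_div_div_le hT₀ h.delta_pos (by linarith) (le_add_of_nonneg_left t.cast_nonneg)
  set L := Real.log (1 / δ)
  set l := Real.log T₀
  have hl : 0 < l := by linarith
  rw [h.learningRate_mul_regStrength]
  calc η * τ * (Real.log ((t + T₀) / δ) / (t + T₀)) ≤ T₀ / l ^ 4 * (Real.log (T₀ / δ) / T₀) :=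
        mul_le_mul h.mul_le hdecay
          (div_nonneg (zero_le_one.trans (h.one_le_log_div t)) (by positivity)) (by positivity)
    _ = (l + L) / l ^ 4 := by rw [hlog_div]; field_simp
    _ ≤ 2 * l / l ^ 4 := by gcongr; linarith
    _ = 2 / l ^ 3 := by field_simp
    _ ≤ 2 / 128 ^ 3 := by gcongr; linarith
    _ ≤ 1 / 2 := by norm_num

theorem four_mul_learningRate_le (h : ParameterBounds K δ η τ T₀) (t : ℕ) :
    4 * learningRate η T₀ t ≤ regStrength τ δ T₀ t := by
  have hs := h.one_le_time t
  have hpow : ((t : ℝ) + T₀) ^ (-(3 / 4) : ℝ) ≤ ((t : ℝ) + T₀) ^ (-(1 / 4) : ℝ) :=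
    Real.rpow_le_rpow_of_exponent_le hs (by norm_num)
  have hcoeff : 4 * η ≤ τ * Real.log ((t + T₀) / δ) :=
    (show 4 * η ≤ 1 by linarith [h.eta_le_one, h.eta_pos]).trans
      (one_le_mul_of_one_le_of_one_le h.one_le_tau (h.one_le_log_div t))
  rw [learningRate, regStrength, ← mul_assoc]
  have := h.eta_pos
  exact mul_le_mul hcoeff hpow (by positivity) (le_trans (by positivity) hcoeff)

theorem learningRate_le_one (h : ParameterBounds K δ η τ T₀) (t : ℕ) : learningRate η T₀ t ≤ 1 :=
  (mul_le_of_le_one_right h.eta_pos.le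
    (Real.rpow_le_one_of_one_le_of_nonpos (h.one_le_time t) (by norm_num))).trans
      (by linarith [h.eta_le_one, h.eta_pos])

theorem admissibleRound (h : ParameterBounds K δ η τ T₀) (t : ℕ) :
    AdmissibleRound K (1 / (8 * √K)) (learningRate η T₀ t) (regStrength τ δ T₀ t)
      (regStrength τ δ T₀ (t + 1)) := by
  have hK := zero_lt_one.trans_le h.one_le_card
  have hs := zero_lt_one.trans_le (h.one_le_time t)
  have hsqrt : 1 ≤ √K := Real.one_le_sqrt.2 h.one_le_card
  have heps_sq : (1 / (8 * √K)) ^ 2 = 1 / (64 * K) := by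
    rw [div_pow, mul_pow, Real.sq_sqrt hK.le]; norm_num
  refine ⟨by positivity, ?_, ?_, h.learningRate_pos t, h.learningRate_le_one t,
    h.regStrength_pos t, h.regStrength_pos _, h.learningRate_mul_regStrength_le_half t,
    h.four_mul_learningRate_le t, ?_⟩
  · gcongr
    linarith
  · rw [heps_sq, mul_one_div_cancel (by positivity)]
  · obtain ⟨hlower, hupper⟩ := h.regStrength_div_mem_Icc t
    refine (abs_le.2 ⟨by linarith, by linarith⟩ : _ ≤ 1 / ((t : ℝ) + T₀)).trans ?_
    have hle := h.card_div_le_learningRate_mul_regStrength t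
    rw [heps_sq, mul_one_div, div_div, le_div_iff₀ (by positivity)]
    have : 0 < 1 / ((t : ℝ) + T₀) * K := by positivity
    linarith

theorem two_div_sq_regStrength_zero_le (h : ParameterBounds K δ η τ T₀) :
    2 / regStrength τ δ T₀ 0 ^ 2 ≤ (1 / (8 * √K)) ^ 2 := by
  have hK := zero_lt_one.trans_le h.one_le_card
  have hT₀ := zero_lt_one.trans_le h.one_le_horizon
  have hδ := h.log_one_div_pos
  have hτ := h.tau_pos
  have hlog := h.le_log_div 0
  have hlog₁ := h.one_le_log_div 0
  have hsq := h.sq_regStrength 0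
  rw [Nat.cast_zero, zero_add] at hlog hlog₁ hsq
  have hsqrt : √T₀ ≤ Real.log (1 / δ) * τ ^ 2 := by
    rw [Real.sqrt_le_left (by positivity), mul_pow, ← pow_mul]
    exact h.le_pow
  rw [hsq, div_pow, mul_pow, Real.sq_sqrt hK.le, one_pow,
    div_le_div_iff₀ (by positivity) (by positivity), one_mul, le_div_iff₀ (by positivity)]
  calc 2 * (8 ^ 2 * K) * √T₀ ≤ 2 * (8 ^ 2 * K) * (Real.log (1 / δ) * τ ^ 2) := by gcongr
    _ ≤ τ ^ 2 * Real.log (T₀ / δ) := by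
      linarith [mul_le_mul_of_nonneg_left hlog (sq_nonneg τ), mul_pos hK (pow_pos hτ 2)]
    _ ≤ τ ^ 2 * Real.log (T₀ / δ) ^ 2 := by
      gcongr
      exact le_self_pow₀ hlog₁ two_ne_zero

theorem contraction_sq_regStrength_le (h : ParameterBounds K δ η τ T₀) (t : ℕ) :
    (1 - learningRate η T₀ t * regStrength τ δ T₀ t / 2) * regStrength τ δ T₀ t ^ 2 ≤
      regStrength τ δ T₀ (t + 1) ^ 2 := by
  have hs := zero_lt_one.trans_le (h.one_le_time t)
  have hτ := h.regStrength_pos t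
  have hτ' := h.regStrength_pos (t + 1)
  have hratio := (div_le_iff₀ hτ').1 (h.regStrength_div_mem_Icc t).2
  have hcard := h.card_div_le_learningRate_mul_regStrength t
  set r := 1 / ((t : ℝ) + T₀)
  have hr : 0 < r := by positivity
  have hcontr : 1 - learningRate η T₀ t * regStrength τ δ T₀ t / 2 ≤ 1 - 3 * r := by
    linarith [mul_le_mul_of_nonneg_right h.one_le_card hr.le]
  have hhalf := h.learningRate_mul_regStrength_le_half t
  calc _ ≤ (1 - learningRate η T₀ t * regStrength τ δ T₀ t / 2)
          * ((1 + r) * regStrength τ δ T₀ (t + 1)) ^ 2 := by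
        gcongr
        linarith
    _ ≤ (1 - 3 * r) * ((1 + r) * regStrength τ δ T₀ (t + 1)) ^ 2 := by gcongr
    _ = (1 - 3 * r) * (1 + r) ^ 2 * regStrength τ δ T₀ (t + 1) ^ 2 := by ring
    _ ≤ 1 * regStrength τ δ T₀ (t + 1) ^ 2 := by
        gcongr
        linarith [pow_pos hr 2, pow_pos hr 3]
    _ = _ := one_mul _

/-- The two halves of the error term telescope separately. -/
theorem sq_learningRate_div_add_le (h : ParameterBounds K δ η τ T₀) (t : ℕ) :
    learningRate η T₀ t ^ 2 / regStrength τ δ T₀ t ^ 2 + learningRate η T₀ t ^ 2 ≤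
      η ^ 2 * (4 * (1 / Real.log ((t + T₀) / δ) - 1 / Real.log ((t + T₀ + 1) / δ)))
        + η ^ 2 * (4 * (1 / √(t + T₀) - 1 / √(t + T₀ + 1))) := by
  have hs := h.one_le_time t
  have := zero_lt_one.trans_le hs
  have hlog_pos := zero_lt_one.trans_le (h.one_le_log_div t)
  have hτ := h.tau_pos
  have hlog := one_div_mul_sq_log_le hs h.delta_pos (h.one_le_log_div t)
  have hsqrt := one_div_mul_sqrt_le hs
  have hdiv : learningRate η T₀ t ^ 2 / regStrength τ δ T₀ t ^ 2 =
      η ^ 2 * (1 / ((t + T₀) * Real.log ((t + T₀) / δ) ^ 2)) / τ ^ 2 := by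
    rw [h.sq_learningRate, h.sq_regStrength]
    field_simp
  rw [hdiv, h.sq_learningRate]
  refine add_le_add ((div_le_self (by positivity) (one_le_pow₀ h.one_le_tau)).trans ?_) ?_ <;>
    gcongr

theorem error_le (h : ParameterBounds K δ η τ T₀) (t : ℕ) :
    80 * K * (learningRate η T₀ t ^ 2 + (learningRate η T₀ t * regStrength τ δ T₀ t) ^ 2)
        / regStrength τ δ T₀ (t + 1) ^ 2 ≤
      1280 * K * η ^ 2 * ((1 / Real.log ((t + T₀) / δ) + 1 / √(t + T₀))
        - (1 / Real.log (((t + 1 : ℕ) + T₀) / δ) + 1 / √((t + 1 : ℕ) + T₀))) := by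
  have hs := h.one_le_time t
  have hK := zero_le_one.trans h.one_le_card
  have hτ := h.regStrength_pos t
  have hτ' := h.regStrength_pos (t + 1)
  have hsum := h.sq_learningRate_div_add_le t
  have hratio : (regStrength τ δ T₀ t / regStrength τ δ T₀ (t + 1)) ^ 2 ≤ 2 ^ 2 :=
    pow_le_pow_left₀ (by positivity) ((h.regStrength_div_mem_Icc t).2.trans
      (by linarith [(div_le_one (zero_lt_one.trans_le hs)).2 hs])) 2
  rw [Nat.cast_succ, add_right_comm]
  calc _ = 80 * K * (learningRate η T₀ t ^ 2 / regStrength τ δ T₀ t ^ 2 + learningRate η T₀ t ^ 2)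
        * (regStrength τ δ T₀ t / regStrength τ δ T₀ (t + 1)) ^ 2 := by field_simp
    _ ≤ 80 * K * _ * 2 ^ 2 := mul_le_mul (mul_le_mul_of_nonneg_left hsum (by positivity)) hratio
        (by positivity) (mul_nonneg (by positivity) (le_trans (by positivity) hsum))
    _ = _ := by ring

theorem sum_error_le (h : ParameterBounds K δ η τ T₀) (n : ℕ) :
    ∑ t ∈ range n, 80 * K * (learningRate η T₀ t ^ 2
      + (learningRate η T₀ t * regStrength τ δ T₀ t) ^ 2) / regStrength τ δ T₀ (t + 1) ^ 2 ≤ δ := by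
  have hK := h.one_le_card
  have hη := h.eta_pos
  have hlog₀ : 1 / Real.log (((0 : ℕ) + T₀) / δ) ≤ 1 :=
    div_le_one_of_le₀ (h.one_le_log_div 0) (zero_le_one.trans (h.one_le_log_div 0))
  have hsqrt₀ : 1 / √((0 : ℕ) + T₀) ≤ 1 :=
    div_le_one_of_le₀ (Real.one_le_sqrt.2 (h.one_le_time 0)) (Real.sqrt_nonneg _)
  have hlogₙ : 0 ≤ 1 / Real.log ((n + T₀) / δ) :=
    one_div_nonneg.2 (zero_le_one.trans (h.one_le_log_div n))
  have hsqrtₙ : 0 ≤ 1 / √((n : ℝ) + T₀) := by positivity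
  refine (sum_le_sum fun t _ => h.error_le t).trans ?_
  rw [← mul_sum, sum_range_sub' fun t : ℕ => 1 / Real.log ((t + T₀) / δ) + 1 / √(t + T₀)]
  calc _ ≤ 1280 * K * η ^ 2 * 2 := by gcongr; linarith
    _ = 2560 * K * η * η := by ring
    _ ≤ 3200 * K * η * 1 := by gcongr <;> linarith [h.eta_le_one]
    _ ≤ δ := by linarith [h.eta_le]

theorem admissibleSchedule (h : ParameterBounds K δ η τ T₀) :
    AdmissibleSchedule K δ (1 / (8 * √K)) (learningRate η T₀) (regStrength τ δ T₀) :=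
  ⟨h.admissibleRound, h.two_div_sq_regStrength_zero_le, h.contraction_sq_regStrength_le,
    h.sum_error_le⟩

end ParameterBounds

end Parameters

/-! ### Maximal inequality -/

section MaximalInequality

variable {Ω : Type*} [mΩ : MeasurableSpace Ω] {P : Measure Ω}

theorem measureReal_diff_add_setIntegral_le [IsFiniteMeasure P] {f : Ω → ℝ}
    (hf : Integrable f P) {S T : Set Ω} (hS : MeasurableSet S) (hT : MeasurableSet T) (hTS : T ⊆ S)
    (hone : ∀ ω ∈ S \ T, 1 ≤ f ω) :
    P.real (S \ T) + ∫ ω in T, f ω ∂P ≤ ∫ ω in S, f ω ∂P := by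
  have hsplit := integral_inter_add_sdiff (μ := P) (s := S) hT hf.integrableOn
  rw [Set.inter_eq_self_of_subset_right hTS] at hsplit
  have hmarkov := setIntegral_ge_of_const_le_real (hS.diff hT) (measure_ne_top P _) hone
    hf.integrableOn
  linarith

section Supermartingale

variable {𝓕 : Filtration ℕ mΩ} {Y : ℕ → Ω → ℝ} {e : ℕ → ℝ}

theorem measurableSet_forall_le_one (hY : StronglyAdapted 𝓕 Y) (n : ℕ) :
    MeasurableSet[𝓕 n] {ω | ∀ t ≤ n, Y t ω ≤ 1} := by
  simp only [Set.ofPred_forall]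
  exact .iInter fun t => .iInter fun ht => 𝓕.mono ht _ ((hY t).measurable measurableSet_Iic)

/-- Stopping at the first exceedance of `1`: the probability of having exceeded, plus the part of
the process that is still running, is again a supermartingale up to the errors `e`. -/
theorem measureReal_compl_forall_le_one_add_setIntegral_le [IsProbabilityMeasure P]
    (hY : StronglyAdapted 𝓕 Y)
    (hint : ∀ t, Integrable (Y t) P) (he : ∀ t, 0 ≤ e t)
    (hstep : ∀ t, P[Y (t + 1) | 𝓕 t] ≤ᵐ[P] fun ω => Y t ω + e t) (n : ℕ) :
    P.real {ω | ∀ t ≤ n, Y t ω ≤ 1}ᶜ + ∫ ω in {ω | ∀ t ≤ n, Y t ω ≤ 1}, Y n ω ∂P ≤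
      P[Y 0] + ∑ t ∈ range n, e t := by
  have hmeas (n : ℕ) := 𝓕.le n _ (measurableSet_forall_le_one hY n)
  induction n with
  | zero =>
    simpa [Set.compl_eq_univ_sdiff] using measureReal_diff_add_setIntegral_le (hint 0) .univ
      (hmeas 0) (Set.subset_univ _) fun ω hω => le_of_lt <| not_le.1 fun hle =>
        hω.2 fun t ht => by rwa [Nat.le_zero.1 ht]
  | succ n ih =>
    set S := {ω | ∀ t ≤ n, Y t ω ≤ 1}
    set T := {ω | ∀ t ≤ n + 1, Y t ω ≤ 1}
    have hTS : T ⊆ S := fun ω hω t ht => hω t (ht.trans n.le_succ)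
    have hexceed : ∀ ω ∈ S \ T, 1 ≤ Y (n + 1) ω := by
      rintro ω ⟨hωS, hωT⟩
      by_contra! hlt
      exact hωT fun t ht => (Nat.le_succ_iff.1 ht).elim (hωS t) fun h => h ▸ hlt.le
    have hmarkov := measureReal_diff_add_setIntegral_le (hint (n + 1)) (hmeas n) (hmeas (n + 1))
      hTS hexceed
    have hdrift : ∫ ω in S, Y (n + 1) ω ∂P ≤ ∫ ω in S, Y n ω ∂P + e n := by
      calc ∫ ω in S, Y (n + 1) ω ∂P = ∫ ω in S, (P[Y (n + 1) | 𝓕 n]) ω ∂P :=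
            (setIntegral_condExp (𝓕.le n) (hint (n + 1)) (measurableSet_forall_le_one hY n)).symm
        _ ≤ ∫ ω in S, (Y n ω + e n) ∂P :=
            setIntegral_mono_ae integrable_condExp.integrableOn
              ((hint n).add (integrable_const _)).integrableOn (hstep n)
        _ = ∫ ω in S, Y n ω ∂P + P.real S * e n := by
            rw [integral_add (hint n).integrableOn (integrable_const _), setIntegral_const,
              smul_eq_mul]
        _ ≤ _ := by gcongr; exact mul_le_of_le_one_left (he n) measureReal_le_one
    have hcompl : P.real Tᶜ ≤ P.real Sᶜ + P.real (S \ T) := by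
      refine (measureReal_mono fun ω hω => ?_).trans (measureReal_union_le Sᶜ (S \ T))
      exact (em (ω ∈ S)).elim (fun h => .inr ⟨h, hω⟩) .inl
    rw [sum_range_succ]
    linarith

theorem one_sub_le_measureReal_forall_le_one [IsProbabilityMeasure P] (hY : StronglyAdapted 𝓕 Y)
    (hint : ∀ t, Integrable (Y t) P) (hY₀ : ∀ t ω, 0 ≤ Y t ω) (he : ∀ t, 0 ≤ e t)
    (hstep : ∀ t, P[Y (t + 1) | 𝓕 t] ≤ᵐ[P] fun ω => Y t ω + e t) {δ : ℝ}
    (hbudget : ∀ n, P[Y 0] + ∑ t ∈ range n, e t ≤ δ) :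
    1 - δ ≤ P.real {ω | ∀ t, Y t ω ≤ 1} := by
  set S : ℕ → Set Ω := fun n => {ω | ∀ t ≤ n, Y t ω ≤ 1} with hS_def
  have hmeas (n : ℕ) : MeasurableSet (S n) := 𝓕.le n _ (measurableSet_forall_le_one hY n)
  have hanti : Antitone S := fun n n' h ω hω t ht => hω t (ht.trans h)
  have hinter : {ω | ∀ t, Y t ω ≤ 1} = ⋂ n, S n := by
    ext ω
    simp only [hS_def, Set.mem_ofPred_eq, Set.mem_iInter]
    exact ⟨fun h n t _ => h t, fun h t => h t t le_rfl⟩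
  have hlim := (ENNReal.tendsto_toReal (measure_ne_top P (⋂ n, S n))).comp
    (tendsto_measure_iInter_atTop (fun n => (hmeas n).nullMeasurableSet) hanti
      ⟨0, measure_ne_top _ _⟩)
  rw [hinter]
  refine ge_of_tendsto' hlim fun n => ?_
  change 1 - δ ≤ P.real (S n)
  have hville := measureReal_compl_forall_le_one_add_setIntegral_le hY hint he hstep n
  rw [probReal_compl_eq_one_sub (hmeas n)] at hville
  have hrunning : 0 ≤ ∫ ω in S n, Y n ω ∂P := integral_nonneg (hY₀ n)
  linarith [hbudget n]

end Supermartingale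

end MaximalInequality

/-! ### Conditional expectations of the feedback -/

section ConditionalLaw

variable {Ω α : Type*} [MeasurableSpace α] {m : MeasurableSpace Ω} [mΩ : MeasurableSpace Ω]
  {P : Measure Ω} [IsFiniteMeasure P] {E S : Set Ω} {X : Ω → α} {p : Ω → ℝ} {Q : Measure α}
  [IsFiniteMeasure Q]

theorem map_restrict_inter_eq_smul (hm : m ≤ mΩ) (hE : MeasurableSet E) (hX : Measurable X)
    (hp : ∀ ω, 0 ≤ p ω)
    (hlaw : ∀ T, MeasurableSet T →
      P⟦{ω | ω ∈ E ∧ X ω ∈ T} | m⟧ =ᵐ[P] fun ω => p ω * Q.real T)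
    (hS : MeasurableSet[m] S) :
    (P.restrict (S ∩ E)).map X = ENNReal.ofReal (∫ ω in S, p ω ∂P) • Q := by
  ext T hT
  have hset : MeasurableSet {ω | ω ∈ E ∧ X ω ∈ T} := hE.inter (hX hT)
  have hintegral := setIntegral_condExp (μ := P) hm
    (f := Set.indicator {ω | ω ∈ E ∧ X ω ∈ T} fun _ => (1 : ℝ))
    ((integrable_const (1 : ℝ)).indicator hset) hS
  rw [setIntegral_congr_ae (hm S hS) ((hlaw T hT).mono fun ω h _ => h), integral_mul_const,
    setIntegral_indicator hset, setIntegral_const, smul_eq_mul, mul_one] at hintegral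
  have hpre : X ⁻¹' T ∩ (S ∩ E) = S ∩ {ω | ω ∈ E ∧ X ω ∈ T} := by
    ext ω
    simp only [Set.mem_inter_iff, Set.mem_preimage, Set.mem_ofPred_eq]
    tauto
  rw [Measure.map_apply hX hT, Measure.restrict_apply (hX hT), Measure.smul_apply, smul_eq_mul,
    ← ofReal_measureReal (μ := Q), ← ENNReal.ofReal_mul (integral_nonneg hp), hintegral,
    ofReal_measureReal, hpre]

theorem condExp_indicator_comp_of_condLaw (hm : m ≤ mΩ) (hE : MeasurableSet E)
    (hX : Measurable X) (hp : ∀ ω, 0 ≤ p ω) (hpm : StronglyMeasurable[m] p)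
    (hp_int : Integrable p P)
    (hlaw : ∀ T, MeasurableSet T →
      P⟦{ω | ω ∈ E ∧ X ω ∈ T} | m⟧ =ᵐ[P] fun ω => p ω * Q.real T)
    {φ : α → ℝ} (hφ : StronglyMeasurable φ)
    (hφ_int : Integrable (E.indicator (φ ∘ X)) P) :
    P[E.indicator (φ ∘ X) | m] =ᵐ[P] fun ω => p ω * ∫ x, φ x ∂Q := by
  refine (ae_eq_condExp_of_forall_setIntegral_eq hm hφ_int
    (fun S _ _ => (hp_int.mul_const _).integrableOn) (fun S hS _ => ?_)
    (hpm.mul_const _).aestronglyMeasurable).symm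
  have hchange : ∫ ω in S ∩ E, φ (X ω) ∂P = ∫ x, φ x ∂(P.restrict (S ∩ E)).map X :=
    (integral_map hX.aemeasurable hφ.aestronglyMeasurable).symm
  rw [integral_mul_const, setIntegral_indicator hE]
  simp only [Function.comp_apply]
  rw [hchange, map_restrict_inter_eq_smul hm hE hX hp hlaw hS, integral_smul_measure,
    ENNReal.toReal_ofReal (integral_nonneg hp), smul_eq_mul]

end ConditionalLaw

section LowerBound

variable {I : Type*} [Fintype I] [DecidableEq I] {η τ ℓ κ : ℝ} {w w' : I → ℝ} {a : I}

theorem abs_regularizedEstimate_le (hκ : 0 < κ) (hκw : ∀ i, κ ≤ w i)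
    (hℓ : ℓ ∈ Set.Icc (0 : ℝ) 1) (i : I) : |regularizedEstimate τ w a ℓ i| ≤ (1 + |τ|) / κ := by
  have hw (i : I) : 0 < w i := hκ.trans_le (hκw i)
  have hloss : |if i = a then ℓ else 0| ≤ 1 := by
    split_ifs
    · exact (abs_of_nonneg hℓ.1).trans_le hℓ.2
    · simp
  rw [eq_div_of_mul_eq (hw i).ne' ((mul_comm _ _).trans (mul_regularizedEstimate hw i)), abs_div,
    abs_of_pos (hw i)]
  exact div_le_div₀ (by positivity) ((abs_sub _ _).trans (by gcongr)) hκ (hκw i)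

theorem IsMirrorStep.mul_exp_neg_le (hw : w ∈ posSimplex I)
    (h : IsMirrorStep η (regularizedEstimate τ w a ℓ) w w') (hℓ : ℓ ∈ Set.Icc (0 : ℝ) 1)
    (hκ : 0 < κ) (hκw : ∀ i, κ ≤ w i) (i : I) :
    κ * Real.exp (-(|η| * (Fintype.card I * ((1 + |τ|) / κ)) + 1)) ≤ w' i := by
  have hterm (i : I) : |regularizedEstimate τ w a ℓ i * (w i - w' i)| ≤ (1 + |τ|) / κ := by
    rw [abs_mul]
    refine (mul_le_of_le_one_right (abs_nonneg _) (abs_le.2 ⟨?_, ?_⟩)).trans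
      (abs_regularizedEstimate_le hκ hκw hℓ i)
    · linarith [hw.1 i, le_one_of_mem_posSimplex h.1 i]
    · linarith [h.1.1 i, le_one_of_mem_posSimplex hw i]
  have hdiv : itakuraSaito w' w ≤ |η| * (Fintype.card I * ((1 + |τ|) / κ)) := by
    refine (h.itakuraSaito_step_le hw).trans ((le_abs_self _).trans ?_)
    rw [abs_mul, ← nsmul_eq_mul, ← card_univ]
    gcongr
    exact (abs_sum_le_sum_abs _ _).trans (sum_le_card_nsmul _ _ _ fun i _ => hterm i)
  exact (mul_le_mul_of_nonneg_right (hκw i) (Real.exp_pos _).le).trans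
    (mul_exp_neg_le_of_itakuraSaito_le h.1.1 hw.1 hdiv i)

variable [Nonempty I] {δ : ℝ} {T₀ : ℕ}

theorem IsAlgorithmRun.mem_posSimplex {act : ℕ → I} {x : ℕ → ℝ} {w : ℕ → I → ℝ}
    (h : IsAlgorithmRun η τ δ T₀ act x w) : ∀ t, w t ∈ posSimplex I
  | 0 => by simpa only [funext h.init] using const_inv_card_mem_posSimplex
  | t + 1 => (h.step t).1

theorem IsAlgorithmRun.exists_forall_le {Ω : Type*} {act : ℕ → Ω → I} {x : ℕ → Ω → ℝ}
    {w : ℕ → Ω → I → ℝ}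
    (h : ∀ ω, IsAlgorithmRun η τ δ T₀ (fun t => act t ω) (fun t => x t ω) (fun t => w t ω))
    (hx : ∀ t ω, x t ω ∈ Set.Icc (0 : ℝ) 1) (t : ℕ) : ∃ κ > 0, ∀ ω i, κ ≤ w t ω i := by
  induction t with
  | zero => exact ⟨1 / Fintype.card I, by positivity, fun ω i => ((h ω).init i).ge⟩
  | succ t ih =>
    obtain ⟨κ, hκ, hκw⟩ := ih
    exact ⟨_, mul_pos hκ (Real.exp_pos _), fun ω =>
      ((h ω).step t).mul_exp_neg_le ((h ω).mem_posSimplex t) (hx t ω) hκ (hκw ω)⟩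

end LowerBound

section Integrability

variable {Ω I X : Type*} [MeasurableSpace Ω] {P : Measure Ω} [IsFiniteMeasure P]

theorem continuousOn_const_div_apply (c : ℝ) (i : I) :
    ContinuousOn (fun w : I → ℝ => c / w i) {w | ∀ i, 0 < w i} :=
  continuousOn_const.div (continuous_apply i).continuousOn fun _ hw => (hw i).ne'

theorem integrable_comp_of_continuousOn [TopologicalSpace X] [MeasurableSpace X] {s : Set X}
    (hs : IsCompact s) {f : X → ℝ} (hf : ContinuousOn f s) (hfm : Measurable f) {g : Ω → X}
    (hg : Measurable g) (hgs : ∀ ω, g ω ∈ s) : Integrable (fun ω => f (g ω)) P := by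
  obtain ⟨C, hC⟩ := hs.exists_bound_of_continuousOn hf
  exact .of_bound (hfm.comp hg).aestronglyMeasurable C (.of_forall fun ω => hC _ (hgs ω))

variable [Fintype I]

theorem integrable_comp_of_forall_le {f : (I → ℝ) → ℝ} (hf : ContinuousOn f {w | ∀ i, 0 < w i})
    (hfm : Measurable f) {w : Ω → I → ℝ} (hw : Measurable w) (hws : ∀ ω, w ω ∈ posSimplex I)
    {κ : ℝ} (hκ : 0 < κ) (hκw : ∀ ω i, κ ≤ w ω i) : Integrable (fun ω => f (w ω)) P :=
  integrable_comp_of_continuousOn (isCompact_Icc (a := fun _ : I => κ) (b := 1))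
    (hf.mono fun _ hx i => hκ.trans_le (hx.1 i)) hfm hw
    fun ω => ⟨hκw ω, le_one_of_mem_posSimplex (hws ω)⟩

theorem measurable_itakuraSaito (x : I → ℝ) : Measurable (itakuraSaito x) := by
  unfold itakuraSaito
  fun_prop

theorem continuousOn_itakuraSaito {x : I → ℝ} (hx : ∀ i, 0 < x i) :
    ContinuousOn (itakuraSaito x) {w | ∀ i, 0 < w i} := by
  have hratio (i : I) := continuousOn_const_div_apply (x i) i
  exact continuousOn_finsetSum _ fun i _ => ((hratio i).sub continuousOn_const).sub
    ((hratio i).log fun w hw => (div_pos (hx i) (hw i)).ne')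

theorem measurable_stepBound_zero (η τ : ℝ) (x : I → ℝ) :
    Measurable fun w => stepBound η τ x w 0 := by
  have := measurable_itakuraSaito x
  simp only [stepBound, dotProduct_zero]
  fun_prop

theorem continuousOn_stepBound_zero (η τ : ℝ) {x : I → ℝ} (hx : ∀ i, 0 < x i) :
    ContinuousOn (fun w => stepBound η τ x w 0) {w | ∀ i, 0 < w i} := by
  have hratio (i : I) := continuousOn_const_div_apply (x i) i
  have := continuousOn_itakuraSaito hx
  simp only [stepBound, dotProduct_zero]
  fun_prop

end Integrability

section Feedback

variable {A B Ω : Type*}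

theorem importanceEstimate_eq_inv_mul_indicator [DecidableEq A] (w : Ω → A → ℝ) (act : Ω → A)
    (x : Ω → ℝ) (a : A) :
    (fun ω => importanceEstimate (w ω) (act ω) (x ω) a) =
      (fun ω => (w ω a)⁻¹) * {ω | act ω = a}.indicator x := by
  ext ω
  by_cases ha : act ω = a
  · simp [importanceEstimate, ha, div_eq_inv_mul]
  · simp [importanceEstimate, ha, Ne.symm ha]

/-- The game seen by the max-player, who suffers the loss `1 - ℓ`. -/
def MatrixGame.swap (G : MatrixGame A B) : MatrixGame B A where
  law b a := (G.law a b).map unitInterval.measurable_symm.aemeasurable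

theorem MatrixGame.lossMatrix_swap (G : MatrixGame A B) :
    G.swap.lossMatrix = opponentLoss G.lossMatrix := by
  ext b a
  have hint : Integrable (fun x : unitInterval => (x : ℝ)) (G.law a b : Measure unitInterval) :=
    .of_bound measurable_subtype_coe.aestronglyMeasurable 1
      (.of_forall fun x => (Real.norm_of_nonneg x.2.1).trans_le x.2.2)
  simp only [lossMatrix, opponentLoss, Matrix.of_apply, meanLoss, swap,
    ProbabilityMeasure.toMeasure_map]
  rw [integral_map unitInterval.measurable_symm.aemeasurable
    measurable_subtype_coe.aestronglyMeasurable]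
  simp [integral_sub (integrable_const 1) hint]

variable [MeasurableSpace A] [MeasurableSpace B] [mΩ : MeasurableSpace Ω] {G : MatrixGame A B}
  {P : Measure Ω} {𝓕 : Filtration ℕ mΩ} {μ : ℕ → Ω → A → ℝ} {ν : ℕ → Ω → B → ℝ}
  {act₁ : ℕ → Ω → A} {act₂ : ℕ → Ω → B} {loss : ℕ → Ω → unitInterval}

namespace IsBanditPlay

theorem swap (h : IsBanditPlay G P 𝓕 μ ν act₁ act₂ loss) :
    IsBanditPlay G.swap P 𝓕 ν μ act₂ act₁ fun t ω => unitInterval.symm (loss t ω) where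
  measurable_policy₁ := h.measurable_policy₂
  measurable_policy₂ := h.measurable_policy₁
  measurable_act₁ := h.measurable_act₂
  measurable_act₂ := h.measurable_act₁
  measurable_loss t := unitInterval.measurable_symm.comp (h.measurable_loss t)
  cond_law t b a S hS := by
    have hlaw := h.cond_law t a b _ (unitInterval.measurable_symm hS)
    simp only [MatrixGame.swap, ProbabilityMeasure.toMeasure_map,
      map_measureReal_apply unitInterval.measurable_symm hS, mul_comm (ν t _ b)]
    simpa only [Set.mem_preimage, and_left_comm] using hlaw

section Unbiasedness

theorem integrable_loss [IsFiniteMeasure P] (h : IsBanditPlay G P 𝓕 μ ν act₁ act₂ loss) (t : ℕ) :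
    Integrable (fun ω => (loss t ω : ℝ)) P :=
  .of_bound ((measurable_subtype_coe.comp (h.measurable_loss t)).mono (𝓕.le _)
    le_rfl).aestronglyMeasurable 1
    (.of_forall fun ω => (Real.norm_of_nonneg (loss t ω).2.1).trans_le (loss t ω).2.2)

theorem measurableSet_act₁_eq [MeasurableSingletonClass A]
    (h : IsBanditPlay G P 𝓕 μ ν act₁ act₂ loss) (t : ℕ) (a : A) :
    MeasurableSet {ω | act₁ t ω = a} :=
  𝓕.le _ _ (h.measurable_act₁ t (measurableSet_singleton a))

theorem integrable_importanceEstimate [IsFiniteMeasure P] [DecidableEq A]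
    [MeasurableSingletonClass A] {t : ℕ} {κ : ℝ} (h : IsBanditPlay G P 𝓕 μ ν act₁ act₂ loss)
    (hκ : 0 < κ) (hκμ : ∀ ω a, κ ≤ μ t ω a) (a : A) :
    Integrable (fun ω => importanceEstimate (μ t ω) (act₁ t ω) (loss t ω) a) P := by
  rw [importanceEstimate_eq_inv_mul_indicator]
  refine ((h.integrable_loss t).indicator (h.measurableSet_act₁_eq t a)).bdd_mul (c := κ⁻¹)
    (((measurable_pi_apply a).comp (h.measurable_policy₁ t)).inv.mono (𝓕.le t)
      le_rfl).aestronglyMeasurable (.of_forall fun ω => ?_)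
  rw [norm_inv, Real.norm_of_nonneg (hκ.le.trans (hκμ ω a))]
  exact inv_anti₀ hκ (hκμ ω a)

variable [Fintype A] [Fintype B] [MeasurableSingletonClass A] [MeasurableSingletonClass B]
  [IsFiniteMeasure P] {t : ℕ}

theorem condExp_indicator_act_eq_loss (h : IsBanditPlay G P 𝓕 μ ν act₁ act₂ loss)
    (hμ : ∀ ω, μ t ω ∈ posSimplex A) (hν : ∀ ω, ν t ω ∈ posSimplex B) (a : A) (b : B) :
    P[({ω | act₁ t ω = a} ∩ {ω | act₂ t ω = b}).indicator fun ω => (loss t ω : ℝ) | 𝓕 t] =ᵐ[P]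
      fun ω => μ t ω a * ν t ω b * G.lossMatrix a b := by
  have hact := (h.measurableSet_act₁_eq t a).inter (h.swap.measurableSet_act₁_eq t b)
  have hprob_meas : Measurable[𝓕 t] fun ω => μ t ω a * ν t ω b :=
    ((measurable_pi_apply a).comp (h.measurable_policy₁ t)).mul
      ((measurable_pi_apply b).comp (h.measurable_policy₂ t))
  have hprob_nonneg (ω : Ω) : 0 ≤ μ t ω a * ν t ω b :=
    mul_nonneg ((hμ ω).1 a).le ((hν ω).1 b).le
  have hprob_int : Integrable (fun ω => μ t ω a * ν t ω b) P :=
    .of_bound (hprob_meas.mono (𝓕.le t) le_rfl).aestronglyMeasurable 1 <| .of_forall fun ω =>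
      (Real.norm_of_nonneg (hprob_nonneg ω)).trans_le <| mul_le_one₀
        (le_one_of_mem_posSimplex (hμ ω) a) ((hν ω).1 b).le (le_one_of_mem_posSimplex (hν ω) b)
  refine condExp_indicator_comp_of_condLaw (𝓕.le t) hact
    ((h.measurable_loss t).mono (𝓕.le (t + 1)) le_rfl) hprob_nonneg hprob_meas.stronglyMeasurable
    hprob_int (fun T hT => ?_) measurable_subtype_coe.stronglyMeasurable
    ((h.integrable_loss t).indicator hact)
  simpa only [Set.mem_inter_iff, Set.mem_ofPred_eq, and_assoc] using h.cond_law t a b T hT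

theorem condExp_indicator_act₁_eq_loss (h : IsBanditPlay G P 𝓕 μ ν act₁ act₂ loss)
    (hμ : ∀ ω, μ t ω ∈ posSimplex A) (hν : ∀ ω, ν t ω ∈ posSimplex B) (a : A) :
    P[{ω | act₁ t ω = a}.indicator fun ω => (loss t ω : ℝ) | 𝓕 t] =ᵐ[P]
      fun ω => μ t ω a * (G.lossMatrix *ᵥ ν t ω) a := by
  have hsplit : ({ω | act₁ t ω = a}.indicator fun ω => (loss t ω : ℝ)) =
      ∑ b, ({ω | act₁ t ω = a} ∩ {ω | act₂ t ω = b}).indicator fun ω => (loss t ω : ℝ) := by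
    classical
    ext ω
    by_cases ha : act₁ t ω = a <;> simp [Set.indicator_apply, ha]
  have hint (b : B) := (h.integrable_loss t).indicator
    ((h.measurableSet_act₁_eq t a).inter (h.swap.measurableSet_act₁_eq t b))
  rw [hsplit]
  filter_upwards [condExp_finsetSum (s := univ) (fun b _ => hint b) (𝓕 t),
    ae_all_iff.2 (h.condExp_indicator_act_eq_loss hμ hν a)] with ω hsum hcond
  rw [hsum, Finset.sum_apply]
  simp only [hcond, Matrix.mulVec, dotProduct, mul_sum, mul_assoc, mul_comm (ν t ω _)]

theorem condExp_importanceEstimate [DecidableEq A] {κ : ℝ}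
    (h : IsBanditPlay G P 𝓕 μ ν act₁ act₂ loss)
    (hμ : ∀ ω, μ t ω ∈ posSimplex A) (hν : ∀ ω, ν t ω ∈ posSimplex B) (hκ : 0 < κ)
    (hκμ : ∀ ω a, κ ≤ μ t ω a) (a : A) :
    P[fun ω => importanceEstimate (μ t ω) (act₁ t ω) (loss t ω) a | 𝓕 t] =ᵐ[P]
      fun ω => (G.lossMatrix *ᵥ ν t ω) a := by
  have hint := h.integrable_importanceEstimate hκ hκμ a
  rw [importanceEstimate_eq_inv_mul_indicator] at hint ⊢
  filter_upwards [condExp_mul_of_stronglyMeasurable_left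
      ((measurable_pi_apply a).comp (h.measurable_policy₁ t)).inv.stronglyMeasurable hint
      ((h.integrable_loss t).indicator (h.measurableSet_act₁_eq t a)),
    h.condExp_indicator_act₁_eq_loss hμ hν a] with ω hpull hcond
  refine hpull.trans ?_
  rw [Pi.mul_apply, hcond]
  exact inv_mul_cancel_left₀ ((hμ ω).1 a).ne' _

end Unbiasedness

end IsBanditPlay

end Feedback

section ConditionalStepBound

variable {Ω I : Type*} [Fintype I] {m : MeasurableSpace Ω} [mΩ : MeasurableSpace Ω]
  {P : Measure Ω} {F F' u : Ω → I → ℝ} {c : ℝ}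

theorem integrable_dotProduct_of_bound (hm : m ≤ mΩ) (hu : Measurable[m] u)
    (hc : ∀ ω i, |u ω i| ≤ c) (hF : ∀ i, Integrable (F · i) P) :
    Integrable (fun ω => u ω ⬝ᵥ F ω) P :=
  integrable_finsetSum _ fun i _ => (hF i).bdd_mul
    ((measurable_pi_apply i).comp (hu.mono hm le_rfl)).aestronglyMeasurable
    (.of_forall fun ω => hc ω i)

theorem condExp_dotProduct_of_bound (hm : m ≤ mΩ) (hu : Measurable[m] u)
    (hc : ∀ ω i, |u ω i| ≤ c) (hF : ∀ i, Integrable (F · i) P)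
    (hFF' : ∀ i, P[(F · i) | m] =ᵐ[P] (F' · i)) :
    P[fun ω => u ω ⬝ᵥ F ω | m] =ᵐ[P] fun ω => u ω ⬝ᵥ F' ω := by
  have hui (i : I) : Measurable[m] (u · i) := (measurable_pi_apply i).comp hu
  have hint (i : I) : Integrable ((u · i) * (F · i)) P :=
    (hF i).bdd_mul ((hui i).mono hm le_rfl).aestronglyMeasurable (.of_forall fun ω => hc ω i)
  have hsum : (fun ω => u ω ⬝ᵥ F ω) = ∑ i, (u · i) * (F · i) := by
    ext ω
    simp [dotProduct, Finset.sum_apply]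
  rw [hsum]
  filter_upwards [condExp_finsetSum (s := univ) (fun i _ => hint i) m,
    ae_all_iff.2 fun i => condExp_mul_of_stronglyMeasurable_left (m := m)
      (hui i).stronglyMeasurable (hint i) (hF i), ae_all_iff.2 hFF'] with ω hω hpull hcond
  rw [hω, Finset.sum_apply]
  exact sum_congr rfl fun i _ => by rw [hpull i, Pi.mul_apply, hcond i]

theorem stepBound_eq_add (η τ : ℝ) (x w F : I → ℝ) :
    stepBound η τ x w F = stepBound η τ x w 0 + η * ((x - w) ⬝ᵥ F) := by
  simp only [stepBound, dotProduct_zero]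
  ring

variable [IsFiniteMeasure P] {η τ κ : ℝ} {x : I → ℝ} {w : Ω → I → ℝ}

theorem abs_sub_le_one_of_mem_posSimplex {y : I → ℝ} (hx : x ∈ posSimplex I)
    (hy : y ∈ posSimplex I) (i : I) : |(x - y) i| ≤ 1 :=
  abs_sub_le_of_nonneg_of_le (hx.1 i).le (le_one_of_mem_posSimplex hx i) (hy.1 i).le
    (le_one_of_mem_posSimplex hy i)

theorem integrable_stepBound (hx : x ∈ posSimplex I) (hw : Measurable w)
    (hws : ∀ ω, w ω ∈ posSimplex I) (hκ : 0 < κ) (hκw : ∀ ω i, κ ≤ w ω i)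
    (hF : ∀ i, Integrable (F · i) P) : Integrable (fun ω => stepBound η τ x (w ω) (F ω)) P := by
  simp only [stepBound_eq_add η τ x _ (F _)]
  exact (integrable_comp_of_forall_le (continuousOn_stepBound_zero η τ hx.1)
    (measurable_stepBound_zero η τ x) hw hws hκ hκw).add <| .const_mul
      (integrable_dotProduct_of_bound le_rfl (measurable_const.sub hw)
        (fun ω => abs_sub_le_one_of_mem_posSimplex hx (hws ω)) hF) η

theorem condExp_stepBound (hm : m ≤ mΩ) (hx : x ∈ posSimplex I) (hw : Measurable[m] w)
    (hws : ∀ ω, w ω ∈ posSimplex I) (hκ : 0 < κ) (hκw : ∀ ω i, κ ≤ w ω i)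
    (hF : ∀ i, Integrable (F · i) P) (hFF' : ∀ i, P[(F · i) | m] =ᵐ[P] (F' · i)) :
    P[fun ω => stepBound η τ x (w ω) (F ω) | m] =ᵐ[P]
      fun ω => stepBound η τ x (w ω) (F' ω) := by
  have hu : Measurable[m] fun ω => x - w ω := measurable_const.sub hw
  have hc (ω : Ω) := abs_sub_le_one_of_mem_posSimplex hx (hws ω)
  have hbase : Integrable (fun ω => stepBound η τ x (w ω) 0) P :=
    integrable_comp_of_forall_le (continuousOn_stepBound_zero η τ hx.1)
      (measurable_stepBound_zero η τ x) (hw.mono hm le_rfl) hws hκ hκw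
  have hbase_meas : StronglyMeasurable[m] fun ω => stepBound η τ x (w ω) 0 :=
    ((measurable_stepBound_zero η τ x).comp hw).stronglyMeasurable
  simp only [stepBound_eq_add η τ x _ (F _), stepBound_eq_add η τ x _ (F' _)]
  filter_upwards [condExp_add hbase
      ((integrable_dotProduct_of_bound hm hu hc hF).const_mul η) m,
    condExp_smul η (fun ω => (x - w ω) ⬝ᵥ F ω) m,
    condExp_dotProduct_of_bound hm hu hc hF hFF'] with ω hadd hsmul hdot
  refine hadd.trans ?_
  rw [Pi.add_apply, condExp_of_stronglyMeasurable hm hbase_meas hbase]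
  exact congrArg _ (hsmul.trans (congrArg _ hdot))

end ConditionalStepBound

/-! ### Plays of the mirror descent -/

section RelativeDivergence

variable {I J : Type*} [Fintype I] [Fintype J]

/-- The divergence between the reference path and the policies `w` of the players at round `t`, in
units of the radius `τ² / 16` up to which `MatrixGame.exploitabilityGap_le_of_jointDivergence_le`
applies. -/
def relativeDivergence (η τ : ℕ → ℝ) (M : Matrix I J ℝ) (t : ℕ) (w : (I → ℝ) × (J → ℝ)) : ℝ :=
  jointDivergence (referencePath η τ M t) w / (τ t ^ 2 / 16)

theorem IsBanditPlay.stronglyAdapted_relativeDivergence {Ω : Type*} [MeasurableSpace I]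
    [MeasurableSpace J] [mΩ : MeasurableSpace Ω] {G : MatrixGame I J} {P : Measure Ω}
    {𝓕 : Filtration ℕ mΩ} {μ : ℕ → Ω → I → ℝ} {ν : ℕ → Ω → J → ℝ} {act₁ : ℕ → Ω → I}
    {act₂ : ℕ → Ω → J} {loss : ℕ → Ω → unitInterval}
    (h : IsBanditPlay G P 𝓕 μ ν act₁ act₂ loss) (η τ : ℕ → ℝ) (M : Matrix I J ℝ) :
    StronglyAdapted 𝓕 fun t ω => relativeDivergence η τ M t (μ t ω, ν t ω) := fun t =>
  ((((measurable_itakuraSaito _).comp (h.measurable_policy₁ t)).add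
    ((measurable_itakuraSaito _).comp (h.measurable_policy₂ t))).div_const _).stronglyMeasurable

variable [Nonempty I] [Nonempty J] {δ ε : ℝ} {η τ : ℕ → ℝ} {M : Matrix I J ℝ}
  {w : (I → ℝ) × (J → ℝ)}

namespace AdmissibleSchedule

theorem referencePath_mem (h : AdmissibleSchedule (Fintype.card I + Fintype.card J) δ ε η τ)
    (hM : ∀ i j, M i j ∈ Set.Icc (0 : ℝ) 1) (t : ℕ) :
    referencePath η τ M t ∈ residualBall ε (τ t) M :=
  referencePath_mem_residualBall h.round h.init_le hM t

theorem relativeDivergence_nonneg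
    (h : AdmissibleSchedule (Fintype.card I + Fintype.card J) δ ε η τ)
    (hM : ∀ i j, M i j ∈ Set.Icc (0 : ℝ) 1) (t : ℕ) (hw₁ : w.1 ∈ posSimplex I)
    (hw₂ : w.2 ∈ posSimplex J) : 0 ≤ relativeDivergence η τ M t w :=
  have hz := h.referencePath_mem hM t
  div_nonneg (add_nonneg (itakuraSaito_nonneg hz.1.1 hw₁.1) (itakuraSaito_nonneg hz.2.1.1 hw₂.1))
    (by positivity)

theorem stepBound_referencePath_succ_div_le
    (h : AdmissibleSchedule (Fintype.card I + Fintype.card J) δ ε η τ)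
    (hM : ∀ i j, M i j ∈ Set.Icc (0 : ℝ) 1) (t : ℕ) (hw₁ : w.1 ∈ posSimplex I)
    (hw₂ : w.2 ∈ posSimplex J) :
    (stepBound (η t) (τ t) (referencePath η τ M (t + 1)).1 w.1 (M *ᵥ w.2)
        + stepBound (η t) (τ t) (referencePath η τ M (t + 1)).2 w.2 (opponentLoss M *ᵥ w.1))
        / (τ (t + 1) ^ 2 / 16) ≤
      relativeDivergence η τ M t w
        + 80 * (Fintype.card I + Fintype.card J) * (η t ^ 2 + (η t * τ t) ^ 2)
          / τ (t + 1) ^ 2 := by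
  have hτ := (h.round t).tau_pos
  have hτ' := (h.round t).tau_pos'
  have hD : 0 ≤ relativeDivergence η τ M t w := h.relativeDivergence_nonneg hM t hw₁ hw₂
  have hdrift := (h.round t).stepBound_gameStep_add_le hM (h.referencePath_mem hM t) hw₁ hw₂
  have hunits : jointDivergence (referencePath η τ M t) w =
      τ t ^ 2 / 16 * relativeDivergence η τ M t w :=
    (mul_div_cancel₀ _ (by positivity)).symm
  rw [div_le_iff₀ (by positivity), referencePath]
  rw [hunits] at hdrift
  have hcontract := mul_le_mul_of_nonneg_right (h.contraction t) hD
  have herror : 80 * (Fintype.card I + Fintype.card J) * (η t ^ 2 + (η t * τ t) ^ 2)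
      / τ (t + 1) ^ 2 * (τ (t + 1) ^ 2 / 16) =
      5 * (Fintype.card I + Fintype.card J) * (η t ^ 2 + (η t * τ t) ^ 2) := by
    field_simp
    ring
  rw [add_mul, herror]
  linarith

end AdmissibleSchedule

end RelativeDivergence

section Play

variable {A B Ω : Type*} [Fintype A] [Fintype B] [DecidableEq A] [DecidableEq B]
  [MeasurableSpace A] [MeasurableSpace B] [mΩ : MeasurableSpace Ω]

/-- A play in which both players run the mirror descent: the hypotheses of the theorem on the
interaction, in a form that is symmetric under exchanging the players (`IsMirrorDescentPlay.swap`).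
-/
structure IsMirrorDescentPlay (η τ δ : ℝ) (T₀ : ℕ) (G : MatrixGame A B) (P : Measure Ω)
    (𝓕 : Filtration ℕ mΩ) (μ : ℕ → Ω → A → ℝ) (ν : ℕ → Ω → B → ℝ) (act₁ : ℕ → Ω → A)
    (act₂ : ℕ → Ω → B) (loss : ℕ → Ω → unitInterval) : Prop where
  play : IsBanditPlay G P 𝓕 μ ν act₁ act₂ loss
  run₁ : ∀ ω, IsAlgorithmRun η τ δ T₀ (fun t => act₁ t ω) (fun t => (loss t ω : ℝ))
    (fun t => μ t ω)
  run₂ : ∀ ω, IsAlgorithmRun η τ δ T₀ (fun t => act₂ t ω)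
    (fun t => (unitInterval.symm (loss t ω) : ℝ)) (fun t => ν t ω)

variable {η τ δ : ℝ} {T₀ : ℕ} {G : MatrixGame A B} {P : Measure Ω} {𝓕 : Filtration ℕ mΩ}
  {μ : ℕ → Ω → A → ℝ} {ν : ℕ → Ω → B → ℝ} {act₁ : ℕ → Ω → A} {act₂ : ℕ → Ω → B}
  {loss : ℕ → Ω → unitInterval}

namespace IsMirrorDescentPlay

theorem swap (h : IsMirrorDescentPlay η τ δ T₀ G P 𝓕 μ ν act₁ act₂ loss) :
    IsMirrorDescentPlay η τ δ T₀ G.swap P 𝓕 ν μ act₂ act₁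
      fun t ω => unitInterval.symm (loss t ω) where
  play := h.play.swap
  run₁ := h.run₂
  run₂ := by simpa only [unitInterval.symm_symm] using h.run₁

section OnePlayer

variable [Nonempty A] {x : A → ℝ}

theorem mem_posSimplex (h : IsMirrorDescentPlay η τ δ T₀ G P 𝓕 μ ν act₁ act₂ loss) (t : ℕ)
    (ω : Ω) : μ t ω ∈ posSimplex A :=
  (h.run₁ ω).mem_posSimplex t

theorem exists_forall_le (h : IsMirrorDescentPlay η τ δ T₀ G P 𝓕 μ ν act₁ act₂ loss) (t : ℕ) :
    ∃ κ > 0, ∀ ω a, κ ≤ μ t ω a :=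
  IsAlgorithmRun.exists_forall_le h.run₁ (fun t ω => (loss t ω).2) t

theorem integrable_itakuraSaito [IsFiniteMeasure P]
    (h : IsMirrorDescentPlay η τ δ T₀ G P 𝓕 μ ν act₁ act₂ loss) (hx : x ∈ posSimplex A) (t : ℕ) :
    Integrable (fun ω => itakuraSaito x (μ t ω)) P := by
  obtain ⟨κ, hκ, hκμ⟩ := h.exists_forall_le t
  exact integrable_comp_of_forall_le (continuousOn_itakuraSaito hx.1) (measurable_itakuraSaito x)
    ((h.play.measurable_policy₁ t).mono (𝓕.le t) le_rfl) (h.mem_posSimplex t) hκ hκμ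

theorem condExp_itakuraSaito_le [Nonempty B] [MeasurableSingletonClass A]
    [MeasurableSingletonClass B] [IsFiniteMeasure P]
    (h : IsMirrorDescentPlay η τ δ T₀ G P 𝓕 μ ν act₁ act₂ loss) (hx : x ∈ posSimplex A) {t : ℕ}
    (hη : 0 ≤ learningRate η T₀ t) (hητ : learningRate η T₀ t * regStrength τ δ T₀ t ≤ 1 / 2) :
    P[fun ω => itakuraSaito x (μ (t + 1) ω) | 𝓕 t] ≤ᵐ[P] fun ω =>
      stepBound (learningRate η T₀ t) (regStrength τ δ T₀ t) x (μ t ω)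
        (G.lossMatrix *ᵥ ν t ω) := by
  obtain ⟨κ, hκ, hκμ⟩ := h.exists_forall_le t
  have hμ := h.mem_posSimplex t
  have hestimate := h.play.integrable_importanceEstimate hκ hκμ
  have hμ_meas := h.play.measurable_policy₁ t
  exact (condExp_mono (h.integrable_itakuraSaito hx (t + 1))
    (integrable_stepBound hx (hμ_meas.mono (𝓕.le t) le_rfl) hμ hκ hκμ hestimate)
    (.of_forall fun ω => ((h.run₁ ω).step t).itakuraSaito_le_stepBound hη hητ (loss t ω).2
      (hμ ω) hx)).trans_eq
    (condExp_stepBound (𝓕.le t) hx hμ_meas hμ hκ hκμ hestimate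
      (h.play.condExp_importanceEstimate hμ (h.swap.mem_posSimplex t) hκ hκμ))

end OnePlayer

section TwoPlayers

variable [Nonempty A] [Nonempty B] [IsFiniteMeasure P] {z : (A → ℝ) × (B → ℝ)}

theorem integrable_jointDivergence (h : IsMirrorDescentPlay η τ δ T₀ G P 𝓕 μ ν act₁ act₂ loss)
    (hz₁ : z.1 ∈ posSimplex A) (hz₂ : z.2 ∈ posSimplex B) (t : ℕ) :
    Integrable (fun ω => jointDivergence z (μ t ω, ν t ω)) P :=
  (h.integrable_itakuraSaito hz₁ t).add (h.swap.integrable_itakuraSaito hz₂ t)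

theorem condExp_jointDivergence_le [MeasurableSingletonClass A] [MeasurableSingletonClass B]
    (h : IsMirrorDescentPlay η τ δ T₀ G P 𝓕 μ ν act₁ act₂ loss) {t : ℕ}
    (hz₁ : z.1 ∈ posSimplex A) (hz₂ : z.2 ∈ posSimplex B)
    (hη : 0 ≤ learningRate η T₀ t) (hητ : learningRate η T₀ t * regStrength τ δ T₀ t ≤ 1 / 2) :
    P[fun ω => jointDivergence z (μ (t + 1) ω, ν (t + 1) ω) | 𝓕 t] ≤ᵐ[P] fun ω =>
      stepBound (learningRate η T₀ t) (regStrength τ δ T₀ t) z.1 (μ t ω)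
          (G.lossMatrix *ᵥ ν t ω)
        + stepBound (learningRate η T₀ t) (regStrength τ δ T₀ t) z.2 (ν t ω)
          (opponentLoss G.lossMatrix *ᵥ μ t ω) := by
  have hplayer₂ := h.swap.condExp_itakuraSaito_le hz₂ hη hητ
  rw [G.lossMatrix_swap] at hplayer₂
  filter_upwards [condExp_add (h.integrable_itakuraSaito hz₁ (t + 1))
      (h.swap.integrable_itakuraSaito hz₂ (t + 1)) (𝓕 t),
    h.condExp_itakuraSaito_le hz₁ hη hητ, hplayer₂] with ω hadd hle₁ hle₂
  exact hadd.trans_le (add_le_add hle₁ hle₂)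

end TwoPlayers

section Schedule

variable [Nonempty A] [Nonempty B] {ε : ℝ}

theorem relativeDivergence_zero (h : IsMirrorDescentPlay η τ δ T₀ G P 𝓕 μ ν act₁ act₂ loss)
    (ηs τs : ℕ → ℝ) (ω : Ω) : relativeDivergence ηs τs G.lossMatrix 0 (μ 0 ω, ν 0 ω) = 0 := by
  have hμ : μ 0 ω = fun _ => 1 / (Fintype.card A : ℝ) := funext (h.run₁ ω).init
  have hν : ν 0 ω = fun _ => 1 / (Fintype.card B : ℝ) := funext (h.run₂ ω).init
  simp [relativeDivergence, jointDivergence, referencePath, itakuraSaito, hμ, hν]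

theorem condExp_relativeDivergence_le [MeasurableSingletonClass A] [MeasurableSingletonClass B]
    [IsFiniteMeasure P] (h : IsMirrorDescentPlay η τ δ T₀ G P 𝓕 μ ν act₁ act₂ loss)
    (hS : AdmissibleSchedule (Fintype.card A + Fintype.card B) δ ε (learningRate η T₀)
      (regStrength τ δ T₀)) (t : ℕ) :
    P[fun ω => relativeDivergence (learningRate η T₀) (regStrength τ δ T₀) G.lossMatrix (t + 1)
        (μ (t + 1) ω, ν (t + 1) ω) | 𝓕 t] ≤ᵐ[P] fun ω =>
      relativeDivergence (learningRate η T₀) (regStrength τ δ T₀) G.lossMatrix t (μ t ω, ν t ω)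
        + 80 * (Fintype.card A + Fintype.card B)
          * (learningRate η T₀ t ^ 2 + (learningRate η T₀ t * regStrength τ δ T₀ t) ^ 2)
          / regStrength τ δ T₀ (t + 1) ^ 2 := by
  have hz := hS.referencePath_mem G.lossMatrix_mem_Icc (t + 1)
  have hround := hS.round t
  simp only [relativeDivergence, div_eq_inv_mul _ (regStrength τ δ T₀ (t + 1) ^ 2 / 16)]
  filter_upwards [condExp_smul (regStrength τ δ T₀ (t + 1) ^ 2 / 16)⁻¹ (fun ω => jointDivergence
      (referencePath (learningRate η T₀) (regStrength τ δ T₀) G.lossMatrix (t + 1))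
      (μ (t + 1) ω, ν (t + 1) ω)) (𝓕 t),
    h.condExp_jointDivergence_le hz.1 hz.2.1 hround.eta_pos.le hround.mul_le_half]
    with ω hsmul hle
  refine hsmul.trans_le ((mul_le_mul_of_nonneg_left hle (by positivity)).trans ?_)
  rw [← div_eq_inv_mul]
  exact hS.stepBound_referencePath_succ_div_le (w := (μ t ω, ν t ω)) G.lossMatrix_mem_Icc t
    (h.mem_posSimplex t ω) (h.swap.mem_posSimplex t ω)

theorem one_sub_le_measureReal_exploitabilityGap_le [MeasurableSingletonClass A]
    [MeasurableSingletonClass B] [IsProbabilityMeasure P]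
    (h : IsMirrorDescentPlay η τ δ T₀ G P 𝓕 μ ν act₁ act₂ loss)
    (hS : AdmissibleSchedule (Fintype.card A + Fintype.card B) δ ε (learningRate η T₀)
      (regStrength τ δ T₀)) :
    1 - δ ≤ P.real {ω | ∀ t, G.exploitabilityGap (μ t ω) (ν t ω) ≤
      2 * (Fintype.card A + Fintype.card B) * regStrength τ δ T₀ t} := by
  have hz := hS.referencePath_mem G.lossMatrix_mem_Icc
  have hτ (t : ℕ) : 0 < regStrength τ δ T₀ t := (hS.round t).tau_pos
  refine (one_sub_le_measureReal_forall_le_one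
    (h.play.stronglyAdapted_relativeDivergence (learningRate η T₀) (regStrength τ δ T₀)
      G.lossMatrix)
    (fun t => (h.integrable_jointDivergence (hz t).1 (hz t).2.1 t).div_const _)
    (fun t ω => hS.relativeDivergence_nonneg G.lossMatrix_mem_Icc t (h.mem_posSimplex t ω)
      (h.swap.mem_posSimplex t ω))
    (fun t => by positivity) (h.condExp_relativeDivergence_le hS) fun n => ?_).trans
    (measureReal_mono fun ω hω t => ?_)
  · simpa only [h.relativeDivergence_zero, integral_zero, zero_add] using hS.budget n
  · exact G.exploitabilityGap_le_of_jointDivergence_le (hτ t) (hS.round t).eps_pos.le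
      (hS.round t).eps_le (hz t) (h.mem_posSimplex t ω) (h.swap.mem_posSimplex t ω)
      ((div_le_one (by have := hτ t; positivity)).1 (hω t))

end Schedule

end IsMirrorDescentPlay

end Play

end

theorem mainTheorem1 (K : ℕ) (δ : ℝ) (hδ : 0 < δ) :
    ∃ c : ℝ, 0 < c ∧
      ∀ (A : Type*) (B : Type*) [Fintype A] [Fintype B] [DecidableEq A] [DecidableEq B]
        [Nonempty A] [Nonempty B] [MeasurableSpace A] [MeasurableSpace B]
        [MeasurableSingletonClass A] [MeasurableSingletonClass B],
        Fintype.card A + Fintype.card B = K →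
      ∀ (η τ : ℝ) (T₀ : ℕ), ParameterCondition c δ η τ T₀ →
      ∀ (G : MatrixGame A B) (Ω : Type*) [mΩ : MeasurableSpace Ω] (P : Measure Ω)
        [IsProbabilityMeasure P] (𝓕 : Filtration ℕ mΩ)
        (μ : ℕ → Ω → A → ℝ) (ν : ℕ → Ω → B → ℝ)
        (act₁ : ℕ → Ω → A) (act₂ : ℕ → Ω → B) (loss : ℕ → Ω → unitInterval),
        IsBanditPlay G P 𝓕 μ ν act₁ act₂ loss →
        (∀ ω, IsAlgorithmRun η τ δ T₀ (fun t => act₁ t ω) (fun t => (loss t ω : ℝ))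
          (fun t => μ t ω)) →
        (∀ ω, IsAlgorithmRun η τ δ T₀ (fun t => act₂ t ω) (fun t => 1 - (loss t ω : ℝ))
          (fun t => ν t ω)) →
        1 - δ ≤ P.real {ω | ∀ t : ℕ, G.exploitabilityGap (μ t ω) (ν t ω) ≤
          2 * K * τ * Real.log (((t : ℝ) + T₀) / δ) * ((t : ℝ) + T₀) ^ (-(1 / 4) : ℝ)} := by
  rcases le_or_gt 1 δ with hδ₁ | hδ₁
  · refine ⟨1, one_pos, ?_⟩
    intros
    exact (sub_nonpos.2 hδ₁).trans measureReal_nonneg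
  rcases Nat.eq_zero_or_pos K with rfl | hK
  · refine ⟨1, one_pos, ?_⟩
    intro A B _ _ _ _ _ _ _ _ _ _ hcard
    exact absurd (Nat.add_eq_zero_iff.1 hcard).1 Fintype.card_ne_zero
  have hK₁ : (1 : ℝ) ≤ K := mod_cast hK
  refine ⟨parameterConstant K δ, parameterConstant_pos (zero_lt_one.trans_le hK₁) hδ, ?_⟩
  intro A B _ _ _ _ _ _ _ _ _ _ hcard η τ T₀ hpar G Ω mΩ P _ 𝓕 μ ν act₁ act₂ loss hplay hA hB
  have hschedule := (hpar.parameterBounds hK₁ hδ hδ₁).admissibleSchedule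
  have hmirror : IsMirrorDescentPlay η τ δ T₀ G P 𝓕 μ ν act₁ act₂ loss := ⟨hplay, hA, hB⟩
  rw [← hcard, Nat.cast_add] at hschedule
  simpa only [← hcard, Nat.cast_add, regStrength, mul_assoc] using
    hmirror.one_sub_le_measureReal_exploitabilityGap_le hschedule
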